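/- Let $\mathcal A$ be an exact category in the sense of Quillen, that is, an additive category with a class of exact sequences $0\to X\to Y\to Z\to 0$ (conflations $X\to Y\to Z$) satisfying Quillen's axioms. Suppose that $\mathcal A$ has enough projective objects: for each object $X$ there is an admissible epimorphism $P\to X$ with $P$ projective, where an object is projective if every morphism from it lifts along every admissible epimorphism. Let $\operatorname{Proj}\mathcal A$ be the full subcategory of projective objects. Let $\mathbf D^b(\mathcal A)$ be the bounded derived category of $\mathcal A$, i.e. the Verdier quotient of the homotopy category of bounded complexes by the acyclic complexes. Identify $\mathcal A$ with the complexes concentrated in degree zero. A full additive subcategory of a triangulated category is called thick if it is closed under shifts, mapping cones and direct summands. A full additive subcategory $\mathcal C$ of $\mathcal A$ is called thick if it is closed under direct summands and if, for every exact sequence $0\to X\to Y\to Z\to 0$ in $\mathcal A$ with two terms in $\mathcal C$, the third term belongs to $\mathcal C$. All subcategories are understood to be closed under isomorphisms. (1) The map $\mathcal D\mapsto \mathcal D\cap\mathcal A$ is a bijection from the thick subcategories of $\mathbf D^b(\mathcal A)$ containing all projective objects of $\mathcal A$ to the thick subcategories of $\mathcal A$ containing all projective objects. The inverse map sends $\mathcal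 C$ to $\mathbf D^b(\mathcal C)$. Here $\mathcal C$ carries the exact structure inherited from $\mathcal A$, the functor $\mathbf D^b(\mathcal C)\to\mathbf D^b(\mathcal A)$ induced by the inclusion is fully faithful, and $\mathbf D^b(\mathcal C)$ is identified with its essential image. (2) Let $\mathbf D^b(\mathcal A)/\mathbf D^b(\operatorname{Proj}\mathcal A)$ be the stable derived category, i.e. the Verdier quotient of $\mathbf D^b(\mathcal A)$ by the image of $\mathbf D^b(\operatorname{Proj}\mathcal A)$, and let $Q$ be the quotient functor. The map $\mathcal T\mapsto Q^{-1}(\mathcal T)$ is a bijection from the thick subcategories of the stable derived category to the thick subcategories of $\mathbf D^b(\mathcal A)$ containing all projective objects of $\mathcal A$. Consequently $\mathcal T\mapsto Q^{-1}(\mathcal T)\cap\mathcal A$ is a bijection from the thick subcategories of the stable derived category to the thick subcategories of $\mathcal A$ containing all projective objects. -/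

import Mathlib

open CategoryTheory CategoryTheory.Limits CategoryTheory.Pretriangulated ZeroObject

universe v u

/-! ### Exact categories in the sense of Quillen -/

section ExactCategories

variable {A : Type u} [Category.{v} A] [Preadditive A]

/-- `f` is an inflation (admissible monomorphism) for a class `𝓔` of short sequences
if it is the first map of a sequence `X ⟶ Y ⟶ Z` in `𝓔`. -/
def IsInflation (𝓔 : ObjectProperty (ShortComplex A)) {X Y : A} (f : X ⟶ Y) : Prop :=
  ∃ (Z : A) (g : Y ⟶ Z) (w : f ≫ g = 0), 𝓔 (ShortComplex.mk f g w)

/-- `g` is a deflation (admissible epimorphism) for a class `𝓔` of short sequences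
if it is the second map of a sequence `X ⟶ Y ⟶ Z` in `𝓔`. -/
def IsDeflation (𝓔 : ObjectProperty (ShortComplex A)) {Y Z : A} (g : Y ⟶ Z) : Prop :=
  ∃ (X : A) (f : X ⟶ Y) (w : f ≫ g = 0), 𝓔 (ShortComplex.mk f g w)

variable (A) in
/-- An exact structure on an additive category `A`: a class of kernel-cokernel pairs
`X ⟶ Y ⟶ Z` (the conflations, i.e. the exact sequences `0 ⟶ X ⟶ Y ⟶ Z ⟶ 0` of the exact
category), closed under isomorphisms, such that identities are inflations and deflations,
inflations and deflations are closed under composition, pushouts of inflations along arbitrary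
morphisms exist and are inflations, and pullbacks of deflations along arbitrary morphisms exist
and are deflations. -/
structure ExactStructure where
  conflation : ObjectProperty (ShortComplex A)
  of_iso : ∀ {S T : ShortComplex A}, (S ≅ T) → conflation S → conflation T
  isKernel : ∀ {S : ShortComplex A}, conflation S →
    Nonempty (IsLimit (KernelFork.ofι S.f S.zero))
  isCokernel : ∀ {S : ShortComplex A}, conflation S →
    Nonempty (IsColimit (CokernelCofork.ofπ S.g S.zero))
  inflation_id : ∀ X : A, IsInflation conflation (𝟙 X)
  deflation_id : ∀ X : A, IsDeflation conflation (𝟙 X)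
  inflation_comp : ∀ {X Y Z : A} (i : X ⟶ Y) (j : Y ⟶ Z),
    IsInflation conflation i → IsInflation conflation j → IsInflation conflation (i ≫ j)
  deflation_comp : ∀ {X Y Z : A} (p : X ⟶ Y) (q : Y ⟶ Z),
    IsDeflation conflation p → IsDeflation conflation q → IsDeflation conflation (p ≫ q)
  pushout : ∀ {X Y X' : A} (i : X ⟶ Y) (a : X ⟶ X'), IsInflation conflation i →
    ∃ (Y' : A) (a' : Y ⟶ Y') (i' : X' ⟶ Y'), IsPushout i a a' i' ∧ IsInflation conflation i'
  pullback : ∀ {Y Z Z' : A} (p : Y ⟶ Z) (b : Z' ⟶ Z), IsDeflation conflation p →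
    ∃ (Y' : A) (b' : Y' ⟶ Y) (p' : Y' ⟶ Z'), IsPullback b' p' p b ∧ IsDeflation conflation p'

/-- Full additive subcategories, closed under isomorphisms. -/
class IsAdditiveSubcategory [HasBinaryBiproducts A] (C : ObjectProperty A) : Prop
    extends C.ContainsZero, C.IsClosedUnderIsomorphisms where
  biprod : ∀ {X Y : A}, C X → C Y → C (X ⊞ Y)

instance [HasZeroObject A] [HasBinaryBiproducts A] (C : ObjectProperty A)
    [hC : IsAdditiveSubcategory C] : HasBinaryBiproducts C.FullSubcategory := by
  have : C.IsClosedUnderBinaryProducts :=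
    { limitsOfShape_le := by
        rintro X ⟨p⟩
        refine C.prop_of_iso ?_ (hC.biprod (p.prop_diag_obj (.mk .left))
          (p.prop_diag_obj (.mk .right)))
        exact (biprod.isoProd _ _).trans (IsLimit.conePointUniqueUpToIso (prodIsProd _ _)
          ((IsLimit.postcomposeHomEquiv (diagramIsoPair p.diag) _).2 p.isLimit)) }
  exact HasBinaryBiproducts.of_hasBinaryProducts

namespace ExactStructure

variable (E : ExactStructure A)

/-- The projective objects of the exact category: those `P` such that every morphism from `P` to
the target of a deflation lifts along the deflation. -/
def projectives : ObjectProperty A := fun P =>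
  ∀ ⦃Y Z : A⦄ (p : Y ⟶ Z), IsDeflation E.conflation p → ∀ h : P ⟶ Z, ∃ l : P ⟶ Y, l ≫ p = h

/-- Every object is the target of a deflation with projective source. -/
def EnoughProjectives : Prop :=
  ∀ X : A, ∃ (P : A) (p : P ⟶ X), E.projectives P ∧ IsDeflation E.conflation p

/-- Full additive subcategories that are closed under extensions. -/
class IsExtensionClosed [HasBinaryBiproducts A] (C : ObjectProperty A) : Prop
    extends IsAdditiveSubcategory C where
  extension : ∀ {S : ShortComplex A}, E.conflation S → C S.X₁ → C S.X₃ → C S.X₂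

/-- Thick subcategories of an exact category: full additive subcategories that are closed under
direct summands and have the two out of three property for exact sequences. -/
class IsThick [HasBinaryBiproducts A] (C : ObjectProperty A) : Prop
    extends IsAdditiveSubcategory C where
  summand : ∀ {X Y : A}, C (X ⊞ Y) → C X
  two_of_three₁ : ∀ {S : ShortComplex A}, E.conflation S → C S.X₂ → C S.X₃ → C S.X₁
  two_of_three₂ : ∀ {S : ShortComplex A}, E.conflation S → C S.X₁ → C S.X₃ → C S.X₂
  two_of_three₃ : ∀ {S : ShortComplex A}, E.conflation S → C S.X₁ → C S.X₂ → C S.X₃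

instance [HasBinaryBiproducts A] (C : ObjectProperty A) [h : E.IsThick C] :
    E.IsExtensionClosed C where
  extension := h.two_of_three₂

/-! ### The exact structure inherited by an extension closed subcategory -/

variable {E}

lemma mono_f {S : ShortComplex A} (h : E.conflation S) : Mono S.f :=
  mono_of_isLimit_fork (E.isKernel h).some

lemma epi_g {S : ShortComplex A} (h : E.conflation S) : Epi S.g :=
  epi_of_isColimit_cofork (E.isCokernel h).some

lemma exists_lift {S : ShortComplex A} (h : E.conflation S) {T : A} (t : T ⟶ S.X₂)
    (ht : t ≫ S.g = 0) : ∃ l : T ⟶ S.X₁, l ≫ S.f = t :=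
  ⟨_, (KernelFork.IsLimit.lift' (E.isKernel h).some t ht).2⟩

lemma exists_desc {S : ShortComplex A} (h : E.conflation S) {T : A} (t : S.X₂ ⟶ T)
    (ht : S.f ≫ t = 0) : ∃ l : S.X₃ ⟶ T, S.g ≫ l = t :=
  ⟨_, (CokernelCofork.IsColimit.desc' (E.isCokernel h).some t ht).2⟩

/-- An inflation forms a conflation with any of its cokernels. -/
lemma conflation_of_cokernel {X Y Z : A} {f : X ⟶ Y} (hf : IsInflation E.conflation f)
    (g : Y ⟶ Z) (w : f ≫ g = 0) [Epi g]
    (hg : ∀ {T : A} (t : Y ⟶ T), f ≫ t = 0 → ∃ l : Z ⟶ T, g ≫ l = t) :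
    E.conflation (ShortComplex.mk f g w) := by
  obtain ⟨Z₀, g₀, w₀, h₀⟩ := hf
  have : Epi g₀ := epi_g h₀
  obtain ⟨a, ha⟩ := hg g₀ w₀
  obtain ⟨b, hb⟩ : ∃ b : Z₀ ⟶ Z, g₀ ≫ b = g := exists_desc h₀ g w
  let e : Z₀ ≅ Z := ⟨b, a, by rw [← cancel_epi g₀, reassoc_of% hb, ha, Category.comp_id],
    by rw [← cancel_epi g, reassoc_of% ha, hb, Category.comp_id]⟩
  let e' : ShortComplex.mk f g₀ w₀ ≅ ShortComplex.mk f g w :=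
    ShortComplex.isoMk (Iso.refl _) (Iso.refl _) e (by simp) (by simpa [e] using hb.symm)
  exact E.of_iso e' h₀

/-- A deflation forms a conflation with any of its kernels. -/
lemma conflation_of_kernel {X Y Z : A} {g : Y ⟶ Z} (hg : IsDeflation E.conflation g)
    (f : X ⟶ Y) (w : f ≫ g = 0) [Mono f]
    (hf : ∀ {T : A} (t : T ⟶ Y), t ≫ g = 0 → ∃ l : T ⟶ X, l ≫ f = t) :
    E.conflation (ShortComplex.mk f g w) := by
  obtain ⟨X₀, f₀, w₀, h₀⟩ := hg
  have : Mono f₀ := mono_f h₀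
  obtain ⟨a, ha⟩ := hf f₀ w₀
  obtain ⟨b, hb⟩ : ∃ b : X ⟶ X₀, b ≫ f₀ = f := exists_lift h₀ f w
  let e : X₀ ≅ X := ⟨a, b, by rw [← cancel_mono f₀, Category.assoc, hb, ha, Category.id_comp],
    by rw [← cancel_mono f, Category.assoc, ha, hb, Category.id_comp]⟩
  let e' : ShortComplex.mk f₀ g w₀ ≅ ShortComplex.mk f g w :=
    ShortComplex.isoMk e (Iso.refl _) (Iso.refl _) (by simpa [e] using ha) (by simp)
  exact E.of_iso e' h₀

/-- The cokernel of a pushout of an inflation. -/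
lemma conflation_pushout {X Y Z X' Y' : A} {i : X ⟶ Y} {p : Y ⟶ Z} {w : i ≫ p = 0}
    (h : E.conflation (ShortComplex.mk i p w)) {a : X ⟶ X'} {a' : Y ⟶ Y'} {i' : X' ⟶ Y'}
    (sq : IsPushout i a a' i') (hi' : IsInflation E.conflation i') :
    ∃ (p' : Y' ⟶ Z) (w' : i' ≫ p' = 0), E.conflation (ShortComplex.mk i' p' w') := by
  have : Epi p := epi_g h
  have e₁ : a' ≫ sq.desc p 0 (by simp [w]) = p := sq.inl_desc _ _ _
  have e₂ : i' ≫ sq.desc p 0 (by simp [w]) = 0 := sq.inr_desc _ _ _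
  have : Epi (sq.desc p 0 (by simp [w])) := by
    have : Epi (a' ≫ sq.desc p 0 (by simp [w])) := by rw [e₁]; infer_instance
    exact epi_of_epi a' _
  refine ⟨_, e₂, conflation_of_cokernel hi' _ _ (fun t ht => ?_)⟩
  obtain ⟨l, hl⟩ : ∃ l, p ≫ l = a' ≫ t :=
    exists_desc h (a' ≫ t) (by
      change i ≫ a' ≫ t = 0
      simp only [sq.w_assoc, ht, comp_zero])
  refine ⟨l, sq.hom_ext ?_ ?_⟩
  · rw [reassoc_of% e₁, hl]
  · rw [reassoc_of% e₂, zero_comp, ht]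

/-- The kernel of a pullback of a deflation. -/
lemma conflation_pullback {X Y Z Z' Y' : A} {i : X ⟶ Y} {p : Y ⟶ Z} {w : i ≫ p = 0}
    (h : E.conflation (ShortComplex.mk i p w)) {b : Z' ⟶ Z} {b' : Y' ⟶ Y} {p' : Y' ⟶ Z'}
    (sq : IsPullback b' p' p b) (hp' : IsDeflation E.conflation p') :
    ∃ (i' : X ⟶ Y') (w' : i' ≫ p' = 0), E.conflation (ShortComplex.mk i' p' w') := by
  have : Mono i := mono_f h
  have e₁ : sq.lift i 0 (by simp [w]) ≫ b' = i := sq.lift_fst _ _ _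
  have e₂ : sq.lift i 0 (by simp [w]) ≫ p' = 0 := sq.lift_snd _ _ _
  have : Mono (sq.lift i 0 (by simp [w])) := by
    have : Mono (sq.lift i 0 (by simp [w]) ≫ b') := by rw [e₁]; infer_instance
    exact mono_of_mono _ b'
  refine ⟨_, e₂, conflation_of_kernel hp' _ _ (fun t ht => ?_)⟩
  obtain ⟨l, hl⟩ : ∃ l, l ≫ i = t ≫ b' :=
    exists_lift h (t ≫ b') (by
      change (t ≫ b') ≫ p = 0
      rw [Category.assoc, sq.w, reassoc_of% ht, zero_comp])
  refine ⟨l, sq.hom_ext ?_ ?_⟩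
  · rw [Category.assoc, e₁, hl]
  · rw [Category.assoc, e₂, comp_zero, ht]

/-- The cokernel of a composition of inflations is an extension of the cokernels. -/
lemma conflation_comp_inflations {X Y Z Q R : A} {i : X ⟶ Y} {p : Y ⟶ Q} {w : i ≫ p = 0}
    (h : E.conflation (ShortComplex.mk i p w)) {j : Y ⟶ Z} {q : Z ⟶ R} {w' : j ≫ q = 0}
    (h' : E.conflation (ShortComplex.mk j q w')) :
    ∃ (W : A) (g : Z ⟶ W) (wg : (i ≫ j) ≫ g = 0) (k : Q ⟶ W) (r : W ⟶ R) (wr : k ≫ r = 0),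
      E.conflation (ShortComplex.mk (i ≫ j) g wg) ∧ E.conflation (ShortComplex.mk k r wr) := by
  obtain ⟨W, p', j', sq, hj'⟩ := E.pushout j p ⟨_, _, _, h'⟩
  obtain ⟨r, wr, hr⟩ := conflation_pushout h' sq hj'
  have : Epi p := epi_g h
  have : Epi p' := ⟨fun s t hst => sq.hom_ext hst (by
    rw [← cancel_epi p, ← sq.w_assoc, hst, sq.w_assoc])⟩
  have wg : (i ≫ j) ≫ p' = 0 := by rw [Category.assoc, sq.w, reassoc_of% w, zero_comp]
  refine ⟨W, p', wg, j', r, wr, conflation_of_cokernel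
    (E.inflation_comp _ _ ⟨_, _, _, h⟩ ⟨_, _, _, h'⟩) _ _ (fun t ht => ?_), hr⟩
  obtain ⟨l, hl⟩ : ∃ l, p ≫ l = j ≫ t := exists_desc h (j ≫ t) (by simpa using ht)
  exact ⟨sq.desc t l hl.symm, sq.inl_desc _ _ _⟩

/-- The kernel of a composition of deflations is an extension of the kernels. -/
lemma conflation_comp_deflations {X Y Z K W : A} {i : X ⟶ Y} {p : Y ⟶ Z} {w : i ≫ p = 0}
    (h : E.conflation (ShortComplex.mk i p w)) {k : K ⟶ Z} {q : Z ⟶ W} {w' : k ≫ q = 0}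
    (h' : E.conflation (ShortComplex.mk k q w')) :
    ∃ (V : A) (f : V ⟶ Y) (wf : f ≫ p ≫ q = 0) (s : X ⟶ V) (r : V ⟶ K) (wr : s ≫ r = 0),
      E.conflation (ShortComplex.mk f (p ≫ q) wf) ∧ E.conflation (ShortComplex.mk s r wr) := by
  obtain ⟨V, k', p', sq, hp'⟩ := E.pullback p k ⟨_, _, _, h⟩
  obtain ⟨s, ws, hs⟩ := conflation_pullback h sq hp'
  have : Mono k := mono_f h'
  have : Mono k' := ⟨fun s t hst => sq.hom_ext hst (by
    rw [← cancel_mono k, Category.assoc, Category.assoc, ← sq.w, reassoc_of% hst])⟩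
  have wf : k' ≫ p ≫ q = 0 := by rw [sq.w_assoc, w', comp_zero]
  refine ⟨V, k', wf, s, p', ws, conflation_of_kernel
    (E.deflation_comp _ _ ⟨_, _, _, h⟩ ⟨_, _, _, h'⟩) _ _ (fun t ht => ?_), hs⟩
  obtain ⟨l, hl⟩ : ∃ l, l ≫ k = t ≫ p := exists_lift h' (t ≫ p) (by simpa using ht)
  exact ⟨sq.lift t l hl.symm, sq.lift_fst _ _ _⟩

variable (E)

variable [HasBinaryBiproducts A]

/-- The exact structure inherited by a full additive extension closed subcategory: a sequence is
a conflation in the subcategory if it is one in the ambient exact category. -/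
def induced (C : ObjectProperty A) [hC : E.IsExtensionClosed C] :
    ExactStructure C.FullSubcategory where
  conflation S := E.conflation (S.map C.ι)
  of_iso e h := E.of_iso (C.ι.mapShortComplex.mapIso e) h
  isKernel {S} h := by
    have : Mono S.f.hom := mono_f h
    choose l hl using fun (T : C.FullSubcategory) (t : T ⟶ S.X₂) (ht : t ≫ S.g = 0) =>
      exists_lift h t.hom (congr_arg InducedCategory.Hom.hom ht)
    exact ⟨KernelFork.IsLimit.ofι _ _ (fun t ht => C.homMk (l _ t ht))
      (fun t ht => by ext; exact hl _ t ht)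
      (fun t ht m hm => by
        ext
        rw [← cancel_mono S.f.hom]
        exact (congr_arg InducedCategory.Hom.hom hm).trans (hl _ t ht).symm)⟩
  isCokernel {S} h := by
    have : Epi S.g.hom := epi_g h
    choose l hl using fun (T : C.FullSubcategory) (t : S.X₂ ⟶ T) (ht : S.f ≫ t = 0) =>
      exists_desc h t.hom (congr_arg InducedCategory.Hom.hom ht)
    exact ⟨CokernelCofork.IsColimit.ofπ _ _ (fun t ht => C.homMk (l _ t ht))
      (fun t ht => by ext; exact hl _ t ht)
      (fun t ht m hm => by
        ext
        rw [← cancel_epi S.g.hom]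
        exact (congr_arg InducedCategory.Hom.hom hm).trans (hl _ t ht).symm)⟩
  inflation_id X := by
    obtain ⟨Z, g, w, h⟩ := E.inflation_id X.obj
    have hg : g = 0 := by simpa using w
    have : Epi g := epi_g h
    have hZ : IsZero Z := by
      rw [IsZero.iff_id_eq_zero, ← cancel_epi g]; simp [hg]
    exact ⟨⟨Z, C.prop_of_isZero hZ⟩, C.homMk g, by ext; exact w, h⟩
  deflation_id X := by
    obtain ⟨Z, g, w, h⟩ := E.deflation_id X.obj
    have hg : g = 0 := by simpa using w
    have : Mono g := mono_f h
    have hZ : IsZero Z := by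
      rw [IsZero.iff_id_eq_zero, ← cancel_mono g]; simp [hg]
    exact ⟨⟨Z, C.prop_of_isZero hZ⟩, C.homMk g, by ext; exact w, h⟩
  inflation_comp := by
    rintro X Y Z i j ⟨Q, p, w, h⟩ ⟨R, q, w', h'⟩
    obtain ⟨W, g, wg, k, r, wr, h₁, h₂⟩ := conflation_comp_inflations (E := E) h h'
    exact ⟨⟨W, hC.extension h₂ Q.property R.property⟩, C.homMk g, by ext; exact wg, h₁⟩
  deflation_comp := by
    rintro X Y Z p q ⟨K, i, w, h⟩ ⟨L, k, w', h'⟩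
    obtain ⟨V, f, wf, s, r, wr, h₁, h₂⟩ := conflation_comp_deflations (E := E) h h'
    exact ⟨⟨V, hC.extension h₂ K.property L.property⟩, C.homMk f, by ext; exact wf, h₁⟩
  pushout := by
    rintro X Y X' i a ⟨Z, p, w, h⟩
    obtain ⟨Y', a', i', sq, hi'⟩ := E.pushout i.hom a.hom ⟨_, _, _, h⟩
    obtain ⟨p', w', h'⟩ := conflation_pushout (E := E) h sq hi'
    refine ⟨⟨Y', hC.extension h' X'.property Z.property⟩, C.homMk a', C.homMk i', ?_,
      Z, C.homMk p', by ext; exact w', h'⟩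
    exact IsPushout.of_map_of_faithful C.ι sq
  pullback := by
    rintro Y Z Z' p b ⟨X, i, w, h⟩
    obtain ⟨Y', b', p', sq, hp'⟩ := E.pullback p.hom b.hom ⟨_, _, _, h⟩
    obtain ⟨i', w', h'⟩ := conflation_pullback (E := E) h sq hp'
    refine ⟨⟨Y', hC.extension h' X.property Z'.property⟩, C.homMk b', C.homMk p', ?_,
      X, C.homMk i', by ext; exact w', h'⟩
    exact IsPullback.of_map_of_faithful C.ι sq

end ExactStructure

end ExactCategories

/-! ### The bounded homotopy category -/

section BoundedHomotopyCategory

variable (A : Type u) [Category.{v} A] [Preadditive A]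

/-- The objects of the homotopy category of cochain complexes that are bounded complexes. -/
def boundedComplexes : ObjectProperty (HomotopyCategory A (ComplexShape.up ℤ)) := fun K =>
  (∃ a : ℤ, CochainComplex.IsStrictlyGE K.as a) ∧ ∃ b : ℤ, CochainComplex.IsStrictlyLE K.as b

instance [HasZeroObject A] : (boundedComplexes A).ContainsZero where
  exists_zero :=
    ⟨(HomotopyCategory.quotient _ _).obj 0, Functor.map_isZero _ (isZero_zero _),
      ⟨0, inferInstanceAs (CochainComplex.IsStrictlyGE (0 : CochainComplex A ℤ) 0)⟩,
      ⟨0, inferInstanceAs (CochainComplex.IsStrictlyLE (0 : CochainComplex A ℤ) 0)⟩⟩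

instance : (boundedComplexes A).IsStableUnderShift ℤ where
  isStableUnderShiftBy n :=
    { le_shift K hK := by
        obtain ⟨K : CochainComplex _ _, rfl⟩ := K.quotient_obj_surjective
        obtain ⟨⟨a, ha⟩, ⟨b, hb⟩⟩ := hK
        rw [ObjectProperty.prop_shift_iff, HomotopyCategory.shift_quotient_obj]
        have ha' : K.IsStrictlyGE a := ha
        have hb' : K.IsStrictlyLE b := hb
        exact ⟨⟨a - n, CochainComplex.isStrictlyGE_shift K a n (a - n) (by lia)⟩,
          ⟨b - n, CochainComplex.isStrictlyLE_shift K b n (b - n) (by lia)⟩⟩ }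

set_option maxHeartbeats 800000 in
instance [HasZeroObject A] [HasBinaryBiproducts A] :
    (boundedComplexes A).IsTriangulatedClosed₃ where
  ext₃' T hT h₁ h₂ := by
    obtain ⟨⟨a₁, _⟩, ⟨b₁, _⟩⟩ := h₁
    obtain ⟨⟨a₂, _⟩, ⟨b₂, _⟩⟩ := h₂
    obtain ⟨f : T.obj₁.as ⟶ T.obj₂.as, hf⟩ :=
      (HomotopyCategory.quotient _ _).map_surjective T.mor₁
    refine ⟨(HomotopyCategory.quotient _ _).obj (CochainComplex.mappingCone f),
      ⟨⟨min (a₁ - 1) a₂, ?_⟩, ⟨max b₁ b₂, ?_⟩⟩,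
      ⟨Triangle.π₃.mapIso (isoTriangleOfIso₁₂ T _ hT
        (HomotopyCategory.mappingCone_triangleh_distinguished f)
        (Iso.refl _) (Iso.refl _) ?_)⟩⟩
    · exact CochainComplex.isStrictlyGE_mappingCone f a₁ a₂ _ (by simp) (by simp)
    · change (CochainComplex.mappingCone f).IsStrictlyLE _
      rw [CochainComplex.isStrictlyLE_iff]
      intro i hi
      simp only [CochainComplex.mappingCone.isZero_X_iff]
      exact ⟨CochainComplex.isZero_of_isStrictlyLE (T.obj₁.as) b₁ _ (by grind),
        CochainComplex.isZero_of_isStrictlyLE (T.obj₂.as) b₂ _ (by grind)⟩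
    · exact (Category.comp_id _).trans (hf.symm.trans (Category.id_comp _).symm)

instance [HasZeroObject A] [HasBinaryBiproducts A] : (boundedComplexes A).IsTriangulated where
  toIsTriangulatedClosed₂ := .of_isTriangulatedClosed₃

/-- The homotopy category `K^b(A)` of bounded cochain complexes. -/
abbrev BoundedHomotopyCategory := (boundedComplexes A).FullSubcategory

variable {A}

/-- The object of `K^b(A)` given by an object of `A`, as a complex concentrated in degree `0`. -/
noncomputable def BoundedHomotopyCategory.single [HasZeroObject A] :
    A ⥤ BoundedHomotopyCategory A :=
  (boundedComplexes A).lift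
    (CochainComplex.singleFunctor A 0 ⋙ HomotopyCategory.quotient A (ComplexShape.up ℤ))
    (fun X => ⟨⟨0, inferInstanceAs
        (CochainComplex.IsStrictlyGE ((CochainComplex.singleFunctor A 0).obj X) 0)⟩,
      ⟨0, inferInstanceAs
        (CochainComplex.IsStrictlyLE ((CochainComplex.singleFunctor A 0).obj X) 0)⟩⟩)

/-- The functor `K^b(A) ⥤ K^b(B)` induced by an additive functor `F : A ⥤ B`, which applies `F`
to complexes degreewise. -/
def BoundedHomotopyCategory.map {B : Type*} [Category* B] [Preadditive B] (F : A ⥤ B)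
    [F.Additive] : BoundedHomotopyCategory A ⥤ BoundedHomotopyCategory B :=
  (boundedComplexes B).lift
    ((boundedComplexes A).ι ⋙ F.mapHomotopyCategory (ComplexShape.up ℤ)) (by
      rintro ⟨X, ⟨a, _⟩, ⟨b, _⟩⟩
      exact ⟨⟨a, inferInstanceAs (CochainComplex.IsStrictlyGE
          ((F.mapHomologicalComplex (ComplexShape.up ℤ)).obj X.as) a)⟩,
        ⟨b, inferInstanceAs (CochainComplex.IsStrictlyLE
          ((F.mapHomologicalComplex (ComplexShape.up ℤ)).obj X.as) b)⟩⟩)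

noncomputable instance {B : Type*} [Category* B] [Preadditive B] (F : A ⥤ B) [F.Additive] :
    (BoundedHomotopyCategory.map F).CommShift ℤ :=
  inferInstanceAs (((boundedComplexes B).lift
    ((boundedComplexes A).ι ⋙ F.mapHomotopyCategory (ComplexShape.up ℤ)) _).CommShift ℤ)

instance {B : Type*} [Category* B] [Preadditive B] (F : A ⥤ B) [F.Additive]
    [HasZeroObject A] [HasBinaryBiproducts A] [HasZeroObject B] [HasBinaryBiproducts B] :
    (BoundedHomotopyCategory.map F).IsTriangulated :=
  inferInstanceAs (((boundedComplexes B).lift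
    ((boundedComplexes A).ι ⋙ F.mapHomotopyCategory (ComplexShape.up ℤ)) _).IsTriangulated)

end BoundedHomotopyCategory

/-! ### Thick subcategories and Verdier quotients of triangulated categories -/

section Triangulated

variable {T : Type*} [Category* T] [HasZeroObject T] [HasShift T ℤ] [Preadditive T]
  [∀ n : ℤ, (shiftFunctor T n).Additive] [Pretriangulated T]

/-- Thick subcategories of a triangulated category: full triangulated subcategories (containing
zero, closed under shifts and cones) that are closed under direct summands. -/
structure IsThickSubcategory (D : ObjectProperty T) : Prop where
  isTriangulated : D.IsTriangulated
  isStableUnderRetracts : D.IsStableUnderRetracts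

/-- The Verdier quotient of a triangulated category by the thick subcategory generated by `S`:
the localization with respect to the morphisms whose cone belongs to that subcategory. -/
def VerdierQuotient (S : ObjectProperty T) := S.triangEnvelope.trW.Localization

namespace VerdierQuotient

variable (S : ObjectProperty T)

instance : Category (VerdierQuotient S) :=
  inferInstanceAs (Category S.triangEnvelope.trW.Localization)

/-- The functor to the Verdier quotient. -/
def functor : T ⥤ VerdierQuotient S := S.triangEnvelope.trW.Q

instance : (functor S).IsLocalization S.triangEnvelope.trW :=
  inferInstanceAs (S.triangEnvelope.trW.Q.IsLocalization S.triangEnvelope.trW)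

noncomputable instance : HasShift (VerdierQuotient S) ℤ :=
  inferInstanceAs (HasShift S.triangEnvelope.trW.Localization ℤ)

noncomputable instance : (functor S).CommShift ℤ :=
  inferInstanceAs (S.triangEnvelope.trW.Q.CommShift ℤ)

variable [IsTriangulated T] [S.Nonempty]

noncomputable instance : Preadditive (VerdierQuotient S) :=
  inferInstanceAs (Preadditive S.triangEnvelope.trW.Localization)

instance : (functor S).Additive :=
  inferInstanceAs S.triangEnvelope.trW.Q.Additive

instance : HasZeroObject (VerdierQuotient S) :=
  inferInstanceAs (HasZeroObject S.triangEnvelope.trW.Localization)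

instance (n : ℤ) : (shiftFunctor (VerdierQuotient S) n).Additive :=
  inferInstanceAs ((shiftFunctor S.triangEnvelope.trW.Localization n).Additive)

/-- The distinguished triangles of the Verdier quotient are those isomorphic to the image of a
distinguished triangle. -/
noncomputable instance : Pretriangulated (VerdierQuotient S) :=
  inferInstanceAs (Pretriangulated S.triangEnvelope.trW.Localization)

instance : (functor S).IsTriangulated :=
  inferInstanceAs S.triangEnvelope.trW.Q.IsTriangulated

instance : IsTriangulated (VerdierQuotient S) :=
  inferInstanceAs (IsTriangulated S.triangEnvelope.trW.Localization)

end VerdierQuotient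

end Triangulated

/-! ### The bounded derived category of an exact category -/

namespace ExactStructure

variable {A : Type u} [Category.{v} A] [Preadditive A] (E : ExactStructure A)

/-- A complex `K` over an exact category is acyclic if every differential factors as
`K.X n ⟶ Z (n + 1) ⟶ K.X (n + 1)` in such a way that the sequences
`Z n ⟶ K.X n ⟶ Z (n + 1)` are conflations. -/
def IsAcyclic (K : CochainComplex A ℤ) : Prop :=
  ∃ (Z : ℤ → A) (i : ∀ n, Z n ⟶ K.X n) (p : ∀ n, K.X n ⟶ Z (n + 1)),
    (∀ n, p n ≫ i (n + 1) = K.d n (n + 1)) ∧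
    ∀ n, ∃ w : i n ≫ p n = 0, E.conflation (ShortComplex.mk (i n) (p n) w)

/-- The bounded acyclic complexes, as objects of `K^b(A)`. -/
def acyclic : ObjectProperty (BoundedHomotopyCategory A) := fun K => E.IsAcyclic K.obj.as

lemma isAcyclic_of_isZero {K : CochainComplex A ℤ} (hK : IsZero K) : E.IsAcyclic K := by
  have hX (n : ℤ) : IsZero (K.X n) :=
    (HomologicalComplex.eval A (ComplexShape.up ℤ) n).map_isZero hK
  refine ⟨K.X, fun n => 𝟙 _, fun n => 0, fun n => (hX n).eq_of_src _ _, fun n => ⟨by simp, ?_⟩⟩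
  obtain ⟨Z, g, w, h⟩ := E.inflation_id (K.X n)
  have : Epi g := epi_g h
  have hg : g = 0 := by simpa using w
  have hZ : IsZero Z := by
    rw [IsZero.iff_id_eq_zero, ← cancel_epi g]; simp [hg]
  let e : ShortComplex.mk (𝟙 (K.X n)) g w ≅
      ShortComplex.mk (𝟙 (K.X n)) (0 : K.X n ⟶ K.X (n + 1)) (by simp) :=
    ShortComplex.isoMk (Iso.refl _) (Iso.refl _) (hZ.iso (hX _)) (by simp)
      ((hX n).eq_of_src _ _)
  exact E.of_iso e h

instance [HasZeroObject A] : E.acyclic.Nonempty :=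
  ObjectProperty.nonempty_of_prop
    (X := ⟨(HomotopyCategory.quotient _ _).obj 0,
      ⟨0, inferInstanceAs (CochainComplex.IsStrictlyGE (0 : CochainComplex A ℤ) 0)⟩,
      ⟨0, inferInstanceAs (CochainComplex.IsStrictlyLE (0 : CochainComplex A ℤ) 0)⟩⟩)
    (E.isAcyclic_of_isZero (isZero_zero _))

variable [HasZeroObject A] [HasBinaryBiproducts A]

/-- The bounded derived category `D^b(A)` of an exact category: the Verdier quotient of `K^b(A)`
by the (thick subcategory generated by the) bounded acyclic complexes. -/
abbrev BoundedDerivedCategory := VerdierQuotient E.acyclic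

/-- The functor `A ⥤ D^b(A)` that sends an object to the complex concentrated in degree `0`. -/
noncomputable def single : A ⥤ E.BoundedDerivedCategory :=
  BoundedHomotopyCategory.single ⋙ VerdierQuotient.functor E.acyclic

/-- The thick subcategory of `D^b(A)` generated by the acyclic complexes is contained in the
preimage under `K^b(C) ⥤ K^b(A)` of the one of `K^b(A)`. -/
lemma acyclic_induced_le (C : ObjectProperty A) [E.IsExtensionClosed C] :
    (E.induced C).acyclic.triangEnvelope ≤
      E.acyclic.triangEnvelope.inverseImage (BoundedHomotopyCategory.map C.ι) := by
  have : (E.acyclic.triangEnvelope.inverseImage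
      (BoundedHomotopyCategory.map C.ι)).IsStableUnderRetracts :=
    ⟨fun r h => ObjectProperty.prop_of_retract E.acyclic.triangEnvelope
      (r.map (BoundedHomotopyCategory.map C.ι)) h⟩
  rw [ObjectProperty.triangEnvelope_le_iff]
  rintro K ⟨Z, i, p, fac, h⟩
  refine ObjectProperty.le_triangEnvelope _ _ ⟨fun n => (Z n).obj, fun n => (i n).hom,
    fun n => (p n).hom, fun n =>
      (congr_arg InducedCategory.Hom.hom (fac n) :), fun n => ?_⟩
  obtain ⟨w, hw⟩ := h n
  exact ⟨congr_arg InducedCategory.Hom.hom w, hw⟩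

/-- For an extension closed subcategory `C` of `A`, endowed with the inherited exact structure,
this is the functor `D^b(C) ⥤ D^b(A)` induced by the inclusion `C ⥤ A`. -/
noncomputable def derivedInclusion (C : ObjectProperty A) [E.IsExtensionClosed C] :
    (E.induced C).BoundedDerivedCategory ⥤ E.BoundedDerivedCategory :=
  Localization.lift (BoundedHomotopyCategory.map C.ι ⋙ VerdierQuotient.functor E.acyclic)
    (fun _ _ f hf => ObjectProperty.inverseImage_trW_isInverted E.acyclic.triangEnvelope
      (BoundedHomotopyCategory.map C.ι) (VerdierQuotient.functor E.acyclic) f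
      (ObjectProperty.trW_monotone (E.acyclic_induced_le C) _ hf))
    (VerdierQuotient.functor (E.induced C).acyclic)

/-! ### The stable derived category -/

/-- The projective objects form an extension closed subcategory. -/
instance : E.IsExtensionClosed E.projectives where
  exists_zero := ⟨0, isZero_zero A, fun _ _ _ _ h => ⟨0, (isZero_zero A).eq_of_src _ _⟩⟩
  of_iso e hP Y Z p hp h := by
    obtain ⟨l, hl⟩ := hP p hp (e.hom ≫ h)
    exact ⟨e.inv ≫ l, by rw [Category.assoc, hl, e.inv_hom_id_assoc]⟩
  biprod hP hQ Y Z p hp h := by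
    obtain ⟨l, hl⟩ := hP p hp (biprod.inl ≫ h)
    obtain ⟨m, hm⟩ := hQ p hp (biprod.inr ≫ h)
    exact ⟨biprod.desc l m, by ext <;> simp [hl, hm]⟩
  extension {S} hS h₁ h₃ Y Z p hp h := by
    obtain ⟨s, hs⟩ := h₃ S.g ⟨_, _, _, hS⟩ (𝟙 _)
    obtain ⟨r, hr⟩ : ∃ r, r ≫ S.f = 𝟙 _ - S.g ≫ s := exists_lift hS _ (by simp [hs])
    obtain ⟨l, hl⟩ := h₁ p hp (S.f ≫ h)
    obtain ⟨m, hm⟩ := h₃ p hp (s ≫ h)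
    refine ⟨r ≫ l + S.g ≫ m, ?_⟩
    rw [Preadditive.add_comp, Category.assoc, Category.assoc, hl, hm, reassoc_of% hr]
    simp

/-- `D^b(Proj A)`, viewed as a full subcategory of `D^b(A)`. -/
def perfect : ObjectProperty E.BoundedDerivedCategory :=
  (E.derivedInclusion E.projectives).essImage

instance : E.perfect.Nonempty :=
  ObjectProperty.nonempty_of_prop
    ((E.derivedInclusion E.projectives).obj_mem_essImage ((E.induced E.projectives).single.obj 0))

/-- The stable derived category `D^b(A)/D^b(Proj A)`. -/
abbrev StableDerivedCategory := VerdierQuotient E.perfect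

/-- The functor from the bounded derived category to the stable derived category. -/
noncomputable abbrev toStable : E.BoundedDerivedCategory ⥤ E.StableDerivedCategory :=
  VerdierQuotient.functor E.perfect

end ExactStructure

section Triangulated

variable {T : Type*} [Category* T] [HasZeroObject T] [HasShift T ℤ] [Preadditive T]
  [∀ n : ℤ, (shiftFunctor T n).Additive] [Pretriangulated T]

/-! ### Exactness for distinguished triangles and closure under extensions -/

namespace DistTriang

variable {X Y Z : T} {f : X ⟶ Y} {g : Y ⟶ Z} {h : Z ⟶ X⟦(1 : ℤ)⟧}

lemma zero₁₂ (hT : Triangle.mk f g h ∈ distTriang T) : f ≫ g = 0 :=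
  comp_distTriang_mor_zero₁₂ _ hT

lemma zero₂₃ (hT : Triangle.mk f g h ∈ distTriang T) : g ≫ h = 0 :=
  comp_distTriang_mor_zero₂₃ _ hT

lemma lift₂ (hT : Triangle.mk f g h ∈ distTriang T) {W : T} (t : W ⟶ Y) (ht : t ≫ g = 0) :
    ∃ l : W ⟶ X, l ≫ f = t :=
  (Triangle.coyoneda_exact₂ _ hT t ht).imp fun _ hl => hl.symm

lemma lift₃ (hT : Triangle.mk f g h ∈ distTriang T) {W : T} (t : W ⟶ Z) (ht : t ≫ h = 0) :
    ∃ l : W ⟶ Y, l ≫ g = t :=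
  (Triangle.coyoneda_exact₃ _ hT t ht).imp fun _ hl => hl.symm

lemma desc₂ (hT : Triangle.mk f g h ∈ distTriang T) {W : T} (t : Y ⟶ W) (ht : f ≫ t = 0) :
    ∃ l : Z ⟶ W, g ≫ l = t :=
  (Triangle.yoneda_exact₂ _ hT t ht).imp fun _ hl => hl.symm

lemma desc₃ (hT : Triangle.mk f g h ∈ distTriang T) {W : T} (t : Z ⟶ W) (ht : g ≫ t = 0) :
    ∃ l : X⟦(1 : ℤ)⟧ ⟶ W, h ≫ l = t :=
  (Triangle.yoneda_exact₃ _ hT t ht).imp fun _ hl => hl.symm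

lemma rot (hT : Triangle.mk f g h ∈ distTriang T) :
    Triangle.mk g h (-f⟦(1 : ℤ)⟧') ∈ distTriang T :=
  rot_of_distTriang _ hT

lemma of_iso (hT : Triangle.mk f g h ∈ distTriang T) {X' Y' Z' : T} {f' : X' ⟶ Y'}
    {g' : Y' ⟶ Z'} {h' : Z' ⟶ X'⟦(1 : ℤ)⟧} (e₁ : X' ≅ X) (e₂ : Y' ≅ Y) (e₃ : Z' ≅ Z)
    (w₁ : f' ≫ e₂.hom = e₁.hom ≫ f) (w₂ : g' ≫ e₃.hom = e₂.hom ≫ g)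
    (w₃ : h' ≫ e₁.hom⟦1⟧' = e₃.hom ≫ h) : Triangle.mk f' g' h' ∈ distTriang T :=
  isomorphic_distinguished _ hT _ (Triangle.isoMk _ _ e₁ e₂ e₃ w₁ w₂ w₃)

lemma of_isIso {X Y Z : T} (f : X ⟶ Y) [IsIso f] (hZ : IsZero Z) :
    Triangle.mk f (0 : Y ⟶ Z) (0 : Z ⟶ X⟦(1 : ℤ)⟧) ∈ distTriang T :=
  of_iso (contractible_distinguished X) (Iso.refl X) (asIso f).symm (hZ.isoZero)
    (by simp) (by simp) (by simp)

end DistTriang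

/-- The smallest class of objects that contains `S` and the zero objects, and that is closed under
extensions. -/
inductive ExtensionClosure (S : ObjectProperty T) : ObjectProperty T
  | zero {X : T} (h : IsZero X) : ExtensionClosure S X
  | of {X : T} (h : S X) : ExtensionClosure S X
  | ext {X Y Z : T} {f : X ⟶ Y} {g : Y ⟶ Z} {h : Z ⟶ X⟦(1 : ℤ)⟧}
      (hT : Triangle.mk f g h ∈ distTriang T) (hX : ExtensionClosure S X)
      (hZ : ExtensionClosure S Z) : ExtensionClosure S Y

namespace ExtensionClosure

variable {S S' : ObjectProperty T}

instance : (ExtensionClosure S).IsClosedUnderIsomorphisms where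
  of_iso {X Y} e hX := by
    exact .ext (DistTriang.of_isIso e.hom (isZero_zero T)) hX (.zero (isZero_zero T))

lemma mono (h : S ≤ ExtensionClosure S') : ExtensionClosure S ≤ ExtensionClosure S' := by
  intro X hX
  induction hX with
  | zero h => exact .zero h
  | of hX => exact h _ hX
  | ext hT _ _ h₁ h₃ => exact .ext hT h₁ h₃

lemma le_of_isTriangulated {Q : ObjectProperty T} [Q.IsTriangulated]
    [Q.IsClosedUnderIsomorphisms] (h : S ≤ Q) : ExtensionClosure S ≤ Q := by
  intro X hX
  induction hX with
  | zero h => exact Q.prop_of_isZero h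
  | of hX => exact h _ hX
  | ext hT _ _ h₁ h₃ => exact Q.ext_of_isTriangulatedClosed₂ _ hT h₁ h₃

lemma map {T' : Type*} [Category* T'] [HasZeroObject T'] [HasShift T' ℤ] [Preadditive T']
    [∀ n : ℤ, (shiftFunctor T' n).Additive] [Pretriangulated T'] (F : T ⥤ T') [F.CommShift ℤ]
    [F.IsTriangulated] {S' : ObjectProperty T'} (h : ∀ X, S X → ExtensionClosure S' (F.obj X))
    {X : T} (hX : ExtensionClosure S X) : ExtensionClosure S' (F.obj X) := by
  induction hX with
  | zero h => exact .zero (F.map_isZero h)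
  | of hX => exact h _ hX
  | ext hT _ _ h₁ h₃ => exact .ext (F.map_distinguished _ hT) h₁ h₃

lemma shift (n : ℤ) (h : ∀ X, S X → ExtensionClosure S' (X⟦n⟧)) {X : T}
    (hX : ExtensionClosure S X) : ExtensionClosure S' (X⟦n⟧) := by
  induction hX with
  | zero h => exact .zero ((shiftFunctor T n).map_isZero h)
  | of hX => exact h _ hX
  | ext hT _ _ h₁ h₃ => exact .ext (Triangle.shift_distinguished _ hT n) h₁ h₃

lemma hom_eq_zero_of_source {X Y : T} (hX : ExtensionClosure S X)
    (h : ∀ Z, S Z → ∀ f : Z ⟶ Y, f = 0) (f : X ⟶ Y) : f = 0 := by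
  induction hX with
  | zero h => exact h.eq_of_src _ _
  | of hX => exact h _ hX f
  | ext hT _ _ h₁ h₃ =>
    obtain ⟨g, hg⟩ := DistTriang.desc₂ hT f (h₁ _)
    rw [← hg, h₃ g, comp_zero]

lemma extensionProduct_le :
    ObjectProperty.extensionProduct (ExtensionClosure S) (ExtensionClosure S) ≤
      ExtensionClosure S := by
  rintro X ⟨_, _, _, _, _, hT, h₁, h₃⟩
  exact .ext hT h₁ h₃

end ExtensionClosure

/-! ### Kernels of localization functors and thick subcategories of Verdier quotients -/

namespace IsThickSubcategory

lemma triangEnvelope_eq [IsTriangulated T] {D : ObjectProperty T} (hD : IsThickSubcategory D) :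
    D.triangEnvelope = D := by
  have := hD.isTriangulated
  have := hD.isStableUnderRetracts
  exact le_antisymm ((ObjectProperty.triangEnvelope_le_iff _).2 le_rfl) D.le_triangEnvelope

lemma inverseImage {T' : Type*} [Category* T'] [HasZeroObject T'] [HasShift T' ℤ]
    [Preadditive T'] [∀ n : ℤ, (shiftFunctor T' n).Additive] [Pretriangulated T']
    (F : T' ⥤ T) [F.CommShift ℤ] [F.IsTriangulated] {D : ObjectProperty T}
    (hD : IsThickSubcategory D) : IsThickSubcategory (D.inverseImage F) := by
  have := hD.isTriangulated
  have := hD.isStableUnderRetracts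
  exact ⟨inferInstance, ⟨fun r h => ObjectProperty.prop_of_retract D (r.map F) h⟩⟩

end IsThickSubcategory

/-- If `L.obj X` vanishes, the identity and zero of `X` agree after composition with some `s` whose
cone is in `P`. Then `s = 0`, and the cone of a zero morphism out of `X` has `X⟦1⟧` as a retract. -/
lemma isZero_obj_iff_of_isLocalization [IsTriangulated T] {P : ObjectProperty T}
    [P.IsTriangulated] [P.IsStableUnderRetracts] {D : Type*} [Category* D] [Preadditive D]
    (L : T ⥤ D) [L.Additive] [L.IsLocalization P.trW] (X : T) :
    IsZero (L.obj X) ↔ P X := by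
  constructor
  · intro h
    have h0 : L.map (𝟙 X) = L.map 0 := h.eq_of_src _ _
    rw [MorphismProperty.map_eq_iff_postcomp L P.trW] at h0
    obtain ⟨Z, s, hs, eq⟩ := h0
    obtain rfl : s = 0 := by simpa using eq
    obtain ⟨C, g, k, hT, hC⟩ := hs
    obtain ⟨l, hl⟩ := DistTriang.lift₂ (DistTriang.rot (DistTriang.rot hT))
      (𝟙 (X⟦(1 : ℤ)⟧)) (by simp)
    have : P (X⟦(1 : ℤ)⟧) := P.prop_of_retract ⟨l, k, hl⟩ hC
    exact (P.prop_shift_iff_of_isStableUnderShift X (1 : ℤ)).1 this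
  · intro h
    have h0 : P.trW (0 : X ⟶ 0) := by
      rw [ObjectProperty.trW_iff']
      refine ⟨X, 𝟙 X, 0, ?_, h⟩
      exact contractible_distinguished X
    have := Localization.inverts L P.trW _ h0
    exact (L.map_isZero (isZero_zero T)).of_iso (asIso (L.map (0 : X ⟶ 0)))

namespace VerdierQuotient

variable [IsTriangulated T] (S : ObjectProperty T) [S.Nonempty]

instance : (functor S).EssSurj := Localization.essSurj _ S.triangEnvelope.trW

lemma isZero_functor_obj_iff (X : T) : IsZero ((functor S).obj X) ↔ S.triangEnvelope X :=
  isZero_obj_iff_of_isLocalization _ _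

lemma isIso_functor_map_iff {X Y : T} (f : X ⟶ Y) :
    IsIso ((functor S).map f) ↔ S.triangEnvelope.trW f := by
  refine ⟨fun h => ?_, Localization.inverts (functor S) S.triangEnvelope.trW f⟩
  obtain ⟨Z, g, k, hT⟩ := distinguished_cocone_triangle f
  refine ⟨Z, g, k, hT, (isZero_functor_obj_iff S Z).1 ?_⟩
  exact (Triangle.isZero₃_iff_isIso₁ _ ((functor S).map_distinguished _ hT)).2 h

variable {S} in
-- The subcategory sought is the kernel of the induced functor to the further quotient by `D`.
-- Defined this way it is visibly closed under isomorphisms and retracts. Extension closure holds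
-- because every triangle of the quotient is isomorphic to the image of a triangle.
lemma exists_thick_inverseImage_eq {D : ObjectProperty T} (hD : IsThickSubcategory D)
    (hS : S ≤ D) : ∃ C : ObjectProperty (VerdierQuotient S), IsThickSubcategory C ∧
      C.inverseImage (functor S) = D := by
  have := hD.isTriangulated
  have := hD.isStableUnderRetracts
  have : D.Nonempty := .mono hS
  let G : VerdierQuotient S ⥤ VerdierQuotient D :=
    Localization.lift (functor D) (fun _ _ f hf => Localization.inverts _ D.triangEnvelope.trW _
      (ObjectProperty.trW_monotone (ObjectProperty.monotone_triangEnvelope hS) _ hf)) (functor S)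
  let e : functor S ⋙ G ≅ functor D := Localization.fac _ _ _
  have hG (X : T) : IsZero (G.obj ((functor S).obj X)) ↔ D X := by
    have h : D.triangEnvelope X ↔ D X := iff_of_eq (congr_fun hD.triangEnvelope_eq X)
    rw [← h, ← isZero_functor_obj_iff]
    exact (e.app X).isZero_iff
  let C : ObjectProperty (VerdierQuotient S) := fun Z => IsZero (G.obj Z)
  have : C.IsClosedUnderIsomorphisms := ⟨fun e h => h.of_iso (G.mapIso e).symm⟩
  refine ⟨C, ⟨?_, ⟨fun r h => ?_⟩⟩, ?_⟩
  · refine { toContainsZero := ?_, toIsStableUnderShift := ⟨fun n => ⟨fun Z hZ => ?_⟩⟩,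
             toIsTriangulatedClosed₂ := .mk' fun Δ hΔ h₁ h₃ => ?_ }
    · refine ⟨(functor S).obj 0, (functor S).map_isZero (isZero_zero T), ?_⟩
      exact (hG 0).2 (D.prop_of_isZero (isZero_zero T))
    · let i := (functor S).objObjPreimageIso Z
      have h₁ : D ((functor S).objPreimage Z) := (hG _).1 (C.prop_of_iso i.symm hZ)
      refine C.prop_of_iso ?_ ((hG _).2 (D.le_shift n _ h₁))
      exact ((functor S).commShiftIso n).app _ ≪≫ (shiftFunctor _ n).mapIso i
    · obtain ⟨Δ', i, hΔ'⟩ := hΔ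
      refine C.prop_of_iso (Triangle.π₂.mapIso i).symm ((hG _).2 ?_)
      exact D.ext_of_isTriangulatedClosed₂ _ hΔ'
        ((hG _).1 (C.prop_of_iso (Triangle.π₁.mapIso i) h₁))
        ((hG _).1 (C.prop_of_iso (Triangle.π₃.mapIso i) h₃))
  · have : Mono (r.map G).i := inferInstance
    exact IsZero.of_mono (r.map G).i h
  · ext X
    exact hG X

lemma exists_equiv_thick :
    ∃ e : {C : ObjectProperty (VerdierQuotient S) // IsThickSubcategory C} ≃
        {D : ObjectProperty T // IsThickSubcategory D ∧ S ≤ D},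
      ∀ C, (e C).1 = C.1.inverseImage (functor S) := by
  let f : {C : ObjectProperty (VerdierQuotient S) // IsThickSubcategory C} →
        {D : ObjectProperty T // IsThickSubcategory D ∧ S ≤ D} := fun C =>
    ⟨C.1.inverseImage (functor S), C.2.inverseImage (functor S), fun X hX => by
      have := C.2.isTriangulated
      have := C.2.isStableUnderRetracts
      exact C.1.prop_of_isZero ((isZero_functor_obj_iff S X).2 (S.le_triangEnvelope _ hX))⟩
  refine ⟨Equiv.ofBijective f ⟨fun C C' h => ?_, fun D => ?_⟩, fun _ => rfl⟩
  · have := C.2.isStableUnderRetracts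
    have := C'.2.isStableUnderRetracts
    ext Z
    have h : C.1 ((functor S).obj ((functor S).objPreimage Z)) ↔
      C'.1 ((functor S).obj ((functor S).objPreimage Z)) :=
      iff_of_eq (congr_fun (congr_arg Subtype.val h) _)
    rwa [C.1.prop_iff_of_iso ((functor S).objObjPreimageIso Z),
      C'.1.prop_iff_of_iso ((functor S).objObjPreimageIso Z)] at h
  · obtain ⟨C, hC, h⟩ := exists_thick_inverseImage_eq D.2.1 D.2.2
    exact ⟨⟨C, hC⟩, Subtype.ext h⟩

end VerdierQuotient

end Triangulated

/-! ### Morphisms out of stalk complexes in the homotopy category -/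

section

open CochainComplex.HomComplex

namespace BoundedHomotopyCategory

section

variable {A : Type u} [Category.{v} A] [Preadditive A] {B : Type*} [Category* B] [Preadditive B]
  (F : A ⥤ B) [F.Additive] [F.Full] [F.Faithful]

instance : (map F).Full := inferInstanceAs ((boundedComplexes B).lift
  ((boundedComplexes A).ι ⋙ F.mapHomotopyCategory (ComplexShape.up ℤ)) _).Full

instance : (map F).Faithful := inferInstanceAs ((boundedComplexes B).lift
  ((boundedComplexes A).ι ⋙ F.mapHomotopyCategory (ComplexShape.up ℤ)) _).Faithful

end

section

variable {A : Type u} [Category.{v} A] [Preadditive A] [HasZeroObject A]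

/-- A chain map out of a stalk complex is a cocycle `X ⟶ K.X n`, and a null homotopy of it is a
factorization through `K.d (n - 1) n`. -/
lemma quotient_map_eq_zero_of_single {n : ℤ} {X : A} {K : CochainComplex A ℤ}
    (f : (CochainComplex.singleFunctor A n).obj X ⟶ K)
    (h : ∀ g : X ⟶ K.X n, g ≫ K.d n (n + 1) = 0 → ∃ l : X ⟶ K.X (n - 1), l ≫ K.d (n - 1) n = g) :
    (HomotopyCategory.quotient A (ComplexShape.up ℤ)).map f = 0 := by
  obtain ⟨g, hg, eq⟩ := Cocycle.fromSingleMk_surjective (Cocycle.equivHom _ _ f) n (add_zero n)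
    (n + 1) rfl
  obtain ⟨l, hl⟩ := h g hg
  rw [HomotopyCategory.quotient_map_eq_zero_iff]
  refine ⟨(Cochain.equivHomotopy f 0).symm ⟨Cochain.fromSingleMk l (by lia), ?_⟩⟩
  rw [Cochain.δ_fromSingleMk l _ 0 n (add_zero n), Cochain.ofHom_zero, add_zero, hl]
  exact (congr_arg Subtype.val eq).symm

instance : (CochainComplex.singleFunctor A 0 ⋙
    HomotopyCategory.quotient A (ComplexShape.up ℤ)).Faithful where
  map_injective {X Y f g} h := by
    obtain ⟨z, hz⟩ := Cochain.equivHomotopy _ _ (HomotopyCategory.homotopyOfEq _ _ h)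
    have hz0 : z = 0 := by
      ext p q hpq
      by_cases hp : p = 0
      · exact (HomologicalComplex.isZero_single_obj_X (ComplexShape.up ℤ) _ _ _
          (by lia)).eq_of_tgt _ _
      · exact (HomologicalComplex.isZero_single_obj_X (ComplexShape.up ℤ) _ _ _ hp).eq_of_src _ _
    rw [hz0, δ_zero, zero_add] at hz
    exact (CochainComplex.singleFunctor A 0).map_injective (Cochain.ofHom_injective hz)

instance : (single (A := A)).Full :=
  Functor.Full.of_comp_faithful_iso (G := (boundedComplexes A).ι)
    (H := CochainComplex.singleFunctor A 0 ⋙ HomotopyCategory.quotient A (ComplexShape.up ℤ))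
    (Iso.refl _)

instance : (single (A := A)).Faithful :=
  Functor.Faithful.of_comp_iso (G := (boundedComplexes A).ι)
    (H := CochainComplex.singleFunctor A 0 ⋙ HomotopyCategory.quotient A (ComplexShape.up ℤ))
    (Iso.refl _)

instance : (single (A := A)).Additive where
  map_add {X Y f g} := by
    apply (boundedComplexes A).ι.map_injective
    exact (CochainComplex.singleFunctor A 0 ⋙
      HomotopyCategory.quotient A (ComplexShape.up ℤ)).map_add

/-- The shift `X[n]` of a complex concentrated in degree `0` is concentrated in degree `-n`. -/
noncomputable def singleShiftIso (X : A) (n m : ℤ) (h : n + m = 0) :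
    ((single.obj X)⟦n⟧).obj ≅ (HomotopyCategory.singleFunctor A m).obj X :=
  ((boundedComplexes A).ι.commShiftIso n).app _ ≪≫
    ((HomotopyCategory.singleFunctors A).shiftIso n m 0 h).app X

lemma hom_single_shift_eq_zero {X : A} {n : ℤ} {K : BoundedHomotopyCategory A}
    (h : ∀ g : X ⟶ K.obj.as.X (-n), g ≫ K.obj.as.d (-n) (-n + 1) = 0 →
      ∃ l : X ⟶ K.obj.as.X (-n - 1), l ≫ K.obj.as.d (-n - 1) (-n) = g)
    (f : (single.obj X)⟦n⟧ ⟶ K) : f = 0 := by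
  obtain ⟨g, hg⟩ : ∃ g, g = (singleShiftIso X n (-n) (by lia)).inv ≫ f.hom := ⟨_, rfl⟩
  obtain ⟨g' : (CochainComplex.singleFunctor A (-n)).obj X ⟶ K.obj.as, rfl⟩ :=
    (HomotopyCategory.quotient _ _).map_surjective g
  apply (boundedComplexes A).ι.map_injective
  change f.hom = 0
  rw [← cancel_epi (singleShiftIso X n (-n) (by lia)).inv, ← hg, comp_zero]
  exact quotient_map_eq_zero_of_single g' h

lemma hom_single_shift_single_shift_eq_zero {X Y : A} {i j : ℤ} (hij : i ≠ j)
    (f : (single.obj X)⟦i⟧ ⟶ (single.obj Y)⟦j⟧) : f = 0 := by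
  obtain ⟨g, hg⟩ : ∃ g, g = (singleShiftIso X i (-i) (by lia)).inv ≫ f.hom ≫
    (singleShiftIso Y j (-j) (by lia)).hom := ⟨_, rfl⟩
  obtain ⟨g' : (CochainComplex.singleFunctor A (-i)).obj X ⟶
    (CochainComplex.singleFunctor A (-j)).obj Y, rfl⟩ :=
    (HomotopyCategory.quotient _ _).map_surjective g
  apply (boundedComplexes A).ι.map_injective
  change f.hom = 0
  rw [← cancel_epi (singleShiftIso X i (-i) (by lia)).inv,
    ← cancel_mono (singleShiftIso Y j (-j) (by lia)).hom, Category.assoc, ← hg, comp_zero,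
    zero_comp]
  refine quotient_map_eq_zero_of_single g' fun g _ => ⟨0, ?_⟩
  exact (HomologicalComplex.isZero_single_obj_X (ComplexShape.up ℤ) _ _ _ (by lia)).eq_of_tgt _ _

end

end BoundedHomotopyCategory

namespace ExactStructure

open BoundedHomotopyCategory

variable {A : Type u} [Category.{v} A] [Preadditive A] (E : ExactStructure A)

/-- A cocycle factors through the kernel `Z n` of the differential, and `K.X (n - 1) ⟶ Z n` is a
deflation, along which morphisms from projectives lift. -/
lemma IsAcyclic.exists_lift {E : ExactStructure A} {K : CochainComplex A ℤ} (hK : E.IsAcyclic K)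
    {P : A} (hP : E.projectives P) (n : ℤ) (g : P ⟶ K.X n) (hg : g ≫ K.d n (n + 1) = 0) :
    ∃ l : P ⟶ K.X (n - 1), l ≫ K.d (n - 1) n = g := by
  obtain ⟨Z, i, p, fac, h⟩ := hK
  obtain ⟨m, rfl⟩ : ∃ m, n = m + 1 := ⟨n - 1, by lia⟩
  have := mono_f (h (m + 1 + 1)).choose_spec
  dsimp at this
  obtain ⟨a, ha⟩ := ExactStructure.exists_lift (h (m + 1)).choose_spec g (by
    rw [← fac, ← Category.assoc] at hg
    rw [← cancel_mono (i (m + 1 + 1)), hg, zero_comp])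
  obtain ⟨l, hl⟩ := hP (p m) ⟨_, _, _, (h m).choose_spec⟩ a
  rw [show m + 1 - 1 = m by lia]
  exact ⟨l, by rw [← fac, reassoc_of% hl]; exact ha⟩

variable [HasZeroObject A] [HasBinaryBiproducts A]

/-- The quotient is taken by the thick closure of the acyclic complexes. The vanishing passes from
the acyclic complexes to this closure because the right orthogonal of all shifts of `P` is itself
thick. -/
lemma hom_single_shift_eq_zero_of_acyclic {P : A} (hP : E.projectives P) {n : ℤ}
    {K : BoundedHomotopyCategory A} (hK : E.acyclic.triangEnvelope K)
    (f : (BoundedHomotopyCategory.single.obj P)⟦n⟧ ⟶ K) : f = 0 := by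
  let S : ObjectProperty (BoundedHomotopyCategory A) :=
    fun X => ∃ n : ℤ, Nonempty (X ≅ (BoundedHomotopyCategory.single.obj P)⟦n⟧)
  have : S.IsStableUnderShift ℤ := ⟨fun a => ⟨fun X ⟨n, ⟨e⟩⟩ => ⟨n + a,
    ⟨(shiftFunctor _ a).mapIso e ≪≫ ((shiftFunctorAdd _ n a).app _).symm⟩⟩⟩⟩
  have : S.rightOrthogonal.IsStableUnderRetracts := ⟨fun r h X f hX => by
    rw [← cancel_mono r.i, h (f ≫ r.i) hX, zero_comp]⟩
  have hS : E.acyclic.triangEnvelope ≤ S.rightOrthogonal := by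
    rw [ObjectProperty.triangEnvelope_le_iff]
    rintro L hL X f ⟨n, ⟨e⟩⟩
    rw [← cancel_epi e.inv, comp_zero]
    exact hom_single_shift_eq_zero (hL.exists_lift hP (-n)) _
  exact hS K hK f ⟨n, ⟨Iso.refl _⟩⟩

end ExactStructure

end

section

open CochainComplex CochainComplex.HomComplex

/-- The shifts `(F.obj X)⟦n⟧` for `X` in `P` and `n` in `I`. -/
def shiftsOf {A T : Type*} [Category* A] [Category* T] [HasShift T ℤ] (F : A ⥤ T)
    (P : ObjectProperty A) (I : Set ℤ) : ObjectProperty T :=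
  fun Y => ∃ (X : A) (n : ℤ), P X ∧ n ∈ I ∧ Nonempty (Y ≅ (F.obj X)⟦n⟧)

/-! ### Generation of the bounded homotopy category -/

namespace CochainComplex

variable {A : Type u} [Category.{v} A] [Preadditive A]

section

variable [HasZeroObject A] (K : CochainComplex A ℤ) (b : ℤ)

/-- The complex obtained from `K` by replacing the object in degree `b` by zero. -/
noncomputable def eraseDegree : CochainComplex A ℤ where
  X n := if n = b then 0 else K.X n
  d i j := if h : i ≠ b ∧ j ≠ b then
    eqToHom (if_neg h.1) ≫ K.d i j ≫ eqToHom (if_neg h.2).symm else 0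
  shape i j hij := by
    rw [K.shape i j hij]
    simp
  d_comp_d' i j k _ _ := by
    by_cases hi : i ≠ b ∧ j ≠ b
    · by_cases hj : j ≠ b ∧ k ≠ b
      · rw [dif_pos hi, dif_pos hj]
        simp
      · rw [dif_neg hj, comp_zero]
    · rw [dif_neg hi, zero_comp]

lemma isZero_eraseDegree_X : IsZero ((K.eraseDegree b).X b) := by
  dsimp [eraseDegree]
  rw [if_pos rfl]
  exact isZero_zero A

/-- The canonical isomorphism outside degree `b`. -/
noncomputable def eraseDegreeXIso (n : ℤ) (hn : n ≠ b) : (K.eraseDegree b).X n ≅ K.X n :=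
  eqToIso (if_neg hn)

lemma eraseDegree_d (i j : ℤ) (hi : i ≠ b) (hj : j ≠ b) :
    (K.eraseDegree b).d i j =
      (K.eraseDegreeXIso b i hi).hom ≫ K.d i j ≫ (K.eraseDegreeXIso b j hj).inv :=
  dif_pos ⟨hi, hj⟩

variable (hb : IsZero (K.X (b + 1)))

/-- The projection onto `K.eraseDegree b` if `K` is zero in degree `b + 1`. -/
noncomputable def toEraseDegree : K ⟶ K.eraseDegree b where
  f n := if hn : n = b then 0 else (K.eraseDegreeXIso b n hn).inv
  comm' i j hij := by
    obtain rfl : i + 1 = j := hij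
    by_cases hj : i + 1 = b
    · obtain rfl : b = i + 1 := hj.symm
      exact (K.isZero_eraseDegree_X (i + 1)).eq_of_tgt _ _
    · by_cases hi : i = b
      · obtain rfl : b = i := hi.symm
        rw [hb.eq_of_tgt (K.d b (b + 1)) 0, dif_pos rfl, zero_comp, zero_comp]
      · rw [dif_neg hi, dif_neg hj, K.eraseDegree_d b i (i + 1) hi hj, Iso.inv_hom_id_assoc]

/-- The inclusion of the object in degree `b` if `K` is zero in degree `b + 1`. -/
noncomputable def fromSingleTop : (singleFunctor A b).obj (K.X b) ⟶ K :=
  HomologicalComplex.mkHomFromSingle (𝟙 _) (by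
    rintro j rfl
    exact hb.eq_of_tgt _ _)

/-- The degreewise split short exact sequence given by the object in degree `b` if `K` is zero in
degree `b + 1`. -/
noncomputable def eraseDegreeShortComplex : ShortComplex (CochainComplex A ℤ) :=
  ShortComplex.mk (K.fromSingleTop b hb) (K.toEraseDegree b hb) (by
    ext n
    by_cases hn : n = b
    · subst hn
      exact (K.isZero_eraseDegree_X n).eq_of_tgt _ _
    · exact (HomologicalComplex.isZero_single_obj_X (ComplexShape.up ℤ) _ _ _ hn).eq_of_src _ _)

lemma isIso_fromSingleTop_f : IsIso ((K.fromSingleTop b hb).f b) := by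
  dsimp [fromSingleTop]
  rw [HomologicalComplex.mkHomFromSingle_f, Category.comp_id]
  exact (HomologicalComplex.singleObjXSelf (ComplexShape.up ℤ) b (K.X b)).isIso_hom

lemma isIso_toEraseDegree_f (n : ℤ) (hn : n ≠ b) : IsIso ((K.toEraseDegree b hb).f n) := by
  dsimp [toEraseDegree]
  rw [dif_neg hn]
  infer_instance

/-- The degreewise splitting of `K.eraseDegreeShortComplex b`. -/
noncomputable def eraseDegreeSplitting (n : ℤ) :
    ((K.eraseDegreeShortComplex b hb).map (HomologicalComplex.eval A _ n)).Splitting :=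
  Nonempty.some (by
    by_cases hn : n = b
    · subst hn
      exact ⟨.ofIsIsoOfIsZero _ (K.isIso_fromSingleTop_f n hb) (K.isZero_eraseDegree_X n)⟩
    · exact ⟨.ofIsZeroOfIsIso _ (HomologicalComplex.isZero_single_obj_X
        (ComplexShape.up ℤ) _ _ _ hn) (K.isIso_toEraseDegree_f b hb n hn)⟩)

end

end CochainComplex

namespace BoundedHomotopyCategory

variable {A : Type u} [Category.{v} A] [Preadditive A]

lemma boundedComplexes_quotient_obj {K : CochainComplex A ℤ} (a b : ℤ)
    (ha : ∀ i, i < a → IsZero (K.X i)) (hb : ∀ i, b < i → IsZero (K.X i)) :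
    boundedComplexes A ((HomotopyCategory.quotient A (ComplexShape.up ℤ)).obj K) :=
  ⟨⟨a, (CochainComplex.isStrictlyGE_iff K a).2 ha⟩, ⟨b, (CochainComplex.isStrictlyLE_iff K b).2 hb⟩⟩

variable [HasZeroObject A] [HasBinaryBiproducts A]

/-- Induction on the width `n` of the window `(b - n, b]` that supports `K`: the top term is a
subcomplex, degreewise split, and the quotient has a window shorter by one. -/
lemma extensionClosure_of_isZero (n : ℕ) (b : ℤ) (K : CochainComplex A ℤ)
    (hK : ∀ i, i ≤ b - n ∨ b < i → IsZero (K.X i))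
    (h : boundedComplexes A ((HomotopyCategory.quotient A (ComplexShape.up ℤ)).obj K)) :
    ExtensionClosure (shiftsOf single ⊤ Set.univ) ⟨_, h⟩ := by
  induction n generalizing K b with
  | zero =>
    refine .zero ?_
    rw [IsZero.iff_id_eq_zero]
    apply (boundedComplexes A).ι.map_injective
    have : IsZero K := by
      rw [IsZero.iff_id_eq_zero]
      ext i
      exact (hK i (by have := le_or_gt i b; simpa)).eq_of_src _ _
    exact ((HomotopyCategory.quotient A (ComplexShape.up ℤ)).map_isZero this).eq_of_src _ _
  | succ n ih =>
    have hb : IsZero (K.X (b + 1)) := hK _ (Or.inr (by lia))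
    let X : BoundedHomotopyCategory A := (single.obj (K.X b))⟦-b⟧
    let i : X.obj ≅ (HomotopyCategory.singleFunctor A b).obj (K.X b) :=
      singleShiftIso (K.X b) (-b) b (by lia)
    let f : X ⟶ ⟨_, h⟩ := ObjectProperty.homMk
      (i.hom ≫ (HomotopyCategory.quotient A (ComplexShape.up ℤ)).map (K.fromSingleTop b hb))
    obtain ⟨C, g, k, hT⟩ := distinguished_cocone_triangle f
    refine .ext hT (.of ⟨K.X b, -b, trivial, trivial, ⟨Iso.refl _⟩⟩) ?_
    have hL' (j : ℤ) (hj : j ≤ b - 1 - n ∨ b - 1 < j) : IsZero ((K.eraseDegree b).X j) := by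
      by_cases hj' : j = b
      · subst hj'
        exact K.isZero_eraseDegree_X j
      · exact (hK j (by push_cast; lia)).of_iso (K.eraseDegreeXIso b j hj')
    let L : BoundedHomotopyCategory A := ⟨(HomotopyCategory.quotient A (ComplexShape.up ℤ)).obj
      (K.eraseDegree b), boundedComplexes_quotient_obj (b - n) (b - 1)
        (fun i hi => hL' i (Or.inl (by lia))) (fun i hi => hL' i (Or.inr hi))⟩
    have hL : ExtensionClosure (shiftsOf single ⊤ Set.univ) L := ih (b - 1) _ hL' _
    let e : C.obj ≅ L.obj :=
      Triangle.π₃.mapIso (isoTriangleOfIso₁₂ ((boundedComplexes A).ι.mapTriangle.obj _)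
        (trianglehOfDegreewiseSplit _ (K.eraseDegreeSplitting b hb))
        ((boundedComplexes A).ι.map_distinguished _ hT)
        ((HomotopyCategory.distinguished_iff_iso_trianglehOfDegreewiseSplit _).2
          ⟨_, _, ⟨Iso.refl _⟩⟩) i (Iso.refl _) (Category.comp_id _))
    exact ObjectProperty.prop_of_iso _ ((boundedComplexes A).isoMk e).symm hL

lemma extensionClosure_shiftsOf_single (K : BoundedHomotopyCategory A) :
    ExtensionClosure (shiftsOf single ⊤ Set.univ) K := by
  obtain ⟨⟨K : CochainComplex A ℤ⟩, h⟩ := K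
  obtain ⟨⟨a, ha⟩, ⟨b, hb⟩⟩ := id h
  -- The window `[a, b]` has `b - a + 1` degrees. If this number is negative, the two bounds
  -- together force every term to vanish.
  refine extensionClosure_of_isZero (b - a + 1).toNat b K (fun i hi => ?_) h
  rcases hi with hi | hi
  · by_cases hab : a ≤ b + 1
    · exact (CochainComplex.isStrictlyGE_iff K a).1 ha i (by lia)
    · by_cases hi' : i < a
      · exact (CochainComplex.isStrictlyGE_iff K a).1 ha i hi'
      · exact (CochainComplex.isStrictlyLE_iff K b).1 hb i (by lia)
  · exact (CochainComplex.isStrictlyLE_iff K b).1 hb i hi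

end BoundedHomotopyCategory

end

section

open CochainComplex CochainComplex.HomComplex

/-! ### Conflations and acyclic complexes -/

namespace CochainComplex.mappingCone

variable {A : Type u} [Category.{v} A] [Preadditive A] [HasBinaryBiproducts A]
  {F G : CochainComplex A ℤ} (φ : F ⟶ G)

lemma isIso_inl_v (p q : ℤ) (h : p + (-1) = q) (hG : IsZero (G.X q)) :
    IsIso ((inl φ).v p q h) := by
  refine ⟨(fst φ).1.v q p (by lia), inl_v_fst_v φ _ _ _, ?_⟩
  have := id_X φ q p (by lia)
  rw [hG.eq_of_src ((inr φ).f q) 0, comp_zero, add_zero] at this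
  exact this

lemma isIso_inr_f (p q : ℤ) (h : p + 1 = q) (hF : IsZero (F.X q)) :
    IsIso ((inr φ).f p) := by
  refine ⟨(snd φ).v p p (add_zero p), inr_f_snd_v φ p, ?_⟩
  have := id_X φ p q h
  rw [hF.eq_of_src ((inl φ).v q p (by lia)) 0, comp_zero, zero_add] at this
  exact this

end CochainComplex.mappingCone

namespace ExactStructure

variable {A : Type u} [Category.{v} A] [Preadditive A] {E : ExactStructure A}

lemma conflation_of_isIso_f (S : ShortComplex A) [IsIso S.f] (h : IsZero S.X₃) :
    E.conflation S := by
  obtain ⟨Z, g, w, hS⟩ := E.inflation_id S.X₁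
  have : Epi g := epi_g hS
  have hZ : IsZero Z := by
    rw [IsZero.iff_id_eq_zero, ← cancel_epi g]
    rw [Category.id_comp] at w
    simp [w]
  let e : ShortComplex.mk (𝟙 S.X₁) g w ≅ S :=
    ShortComplex.isoMk (Iso.refl _) (asIso S.f) (hZ.iso h) rfl (h.eq_of_tgt _ _)
  exact E.of_iso e hS

lemma conflation_of_isIso_g (S : ShortComplex A) [IsIso S.g] (h : IsZero S.X₁) :
    E.conflation S := by
  obtain ⟨Z, f, w, hS⟩ := E.deflation_id S.X₃
  have : Mono f := mono_f hS
  have hZ : IsZero Z := by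
    rw [IsZero.iff_id_eq_zero, ← cancel_mono f]
    rw [Category.comp_id] at w
    simp [w]
  let e : ShortComplex.mk f (𝟙 S.X₃) w ≅ S :=
    ShortComplex.isoMk (hZ.iso h) (asIso S.g).symm (Iso.refl _) (hZ.eq_of_src _ _) (by simp)
  exact E.of_iso e hS

/-- The cycles of a three-term complex are known: the first term in degree `-1`, the last one in
degree `0`, and zero elsewhere. Away from degree `-1` the required conflations are therefore
degenerate, with one zero end and an isomorphism. -/
lemma isAcyclic_of_conflation [HasZeroObject A] (K : CochainComplex A ℤ)
    (hK : ∀ n, n < -2 ∨ 0 < n → IsZero (K.X n))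
    (h : E.conflation (ShortComplex.mk (K.d (-2) (-1)) (K.d (-1) 0) (K.d_comp_d _ _ _))) :
    E.IsAcyclic K := by
  -- Taking `K.X (n - 1)` for every `n ≤ -1` and `K.X n` for every `n ≥ 0` gives the right cycles
  -- with only two cases.
  obtain ⟨Z, a, b⟩ : ∃ Z : ℤ → A, (∀ n ≤ -1, Z n = K.X (n - 1)) ∧ ∀ n, 0 ≤ n → Z n = K.X n :=
    ⟨fun n => if n ≤ -1 then K.X (n - 1) else K.X n, fun n hn => if_pos hn,
      fun n hn => if_neg (by omega)⟩
  obtain ⟨i, hi₁, hi₂⟩ : ∃ i : ∀ n, Z n ⟶ K.X n,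
      (∀ n hn, i n = eqToHom (a n hn) ≫ K.d (n - 1) n) ∧ ∀ n hn, i n = eqToHom (b n hn) :=
    ⟨fun n => if hn : n ≤ -1 then eqToHom (a n hn) ≫ K.d (n - 1) n else eqToHom (b n (by omega)),
      fun n hn => dif_pos hn, fun n hn => dif_neg (by omega)⟩
  obtain ⟨p, hp₁, hp₂⟩ : ∃ p : ∀ n, K.X n ⟶ Z (n + 1),
      (∀ n (hn : n + 1 ≤ -1), p n = (K.XIsoOfEq (show n = n + 1 - 1 by omega)).hom ≫
        eqToHom (a (n + 1) hn).symm) ∧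
      ∀ n (hn : 0 ≤ n + 1), p n = K.d n (n + 1) ≫ eqToHom (b (n + 1) hn).symm :=
    ⟨fun n => if hn : n + 1 ≤ -1 then (K.XIsoOfEq (show n = n + 1 - 1 by omega)).hom ≫
        eqToHom (a (n + 1) hn).symm else K.d n (n + 1) ≫ eqToHom (b (n + 1) (by omega)).symm,
      fun n hn => dif_pos hn, fun n hn => dif_neg (by omega)⟩
  refine ⟨Z, i, p, fun n => ?_, fun n => ?_⟩
  · by_cases hn : n + 1 ≤ -1
    · rw [hi₁ _ hn, hp₁ n hn, Category.assoc, eqToHom_trans_assoc, eqToHom_refl, Category.id_comp,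
        HomologicalComplex.XIsoOfEq_hom_comp_d]
    · rw [hi₂ _ (by omega), hp₂ n (by omega), Category.assoc, eqToHom_trans, eqToHom_refl,
        Category.comp_id]
  · rcases lt_trichotomy n (-1) with hn | rfl | hn
    · have hz : IsZero (Z n) := by
        rw [a n (by omega)]
        exact hK _ (by omega)
      refine ⟨hz.eq_of_src _ _, ?_⟩
      have : IsIso (p n) := by
        rw [hp₁ n (by omega)]
        infer_instance
      have : IsIso (ShortComplex.mk (i n) (p n) (hz.eq_of_src _ _)).g := this
      exact conflation_of_isIso_g _ hz
    · have w : i (-1) ≫ p (-1) = 0 := by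
        rw [hi₁ _ le_rfl, hp₂ _ (by omega), Category.assoc, K.d_comp_d_assoc, zero_comp, comp_zero]
      have hb := b (-1 + 1) (by omega)
      let e : ShortComplex.mk (K.d (-2) (-1)) (K.d (-1) 0) (K.d_comp_d _ _ _) ≅
          ShortComplex.mk (i (-1)) (p (-1)) w :=
        ShortComplex.isoMk (eqToIso (show K.X (-2) = Z (-1) from (a (-1) le_rfl).symm)) (Iso.refl _)
          (eqToIso (show K.X 0 = Z (-1 + 1) from hb.symm))
          (by
            dsimp
            rw [hi₁ _ le_rfl, eqToHom_trans_assoc, eqToHom_refl, Category.id_comp,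
              Category.comp_id]
            rfl)
          (by
            dsimp
            rw [hp₂ _ (by omega), Category.id_comp]
            rfl)
      exact ⟨w, E.of_iso e h⟩
    · have hz : IsZero (Z (n + 1)) := by
        rw [b _ (by omega)]
        exact hK _ (by omega)
      refine ⟨hz.eq_of_tgt _ _, ?_⟩
      have : IsIso (i n) := by
        rw [hi₂ n (by omega)]
        infer_instance
      have : IsIso (ShortComplex.mk (i n) (p n) (hz.eq_of_tgt _ _)).f := this
      exact conflation_of_isIso_f _ hz

variable [HasBinaryBiproducts A]

open mappingCone in
-- Since the complexes sit in degree `0`, the iterated cone is, up to signs, `X ⟶ Y ⟶ Z` placed in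
-- degrees `-2`, `-1`, `0`.
lemma isAcyclic_mappingCone [HasZeroObject A] {X Y Z : CochainComplex A ℤ} (φ : X ⟶ Y) (ψ : Y ⟶ Z)
    (w : φ ≫ ψ = 0) (hX : ∀ n, n ≠ 0 → IsZero (X.X n)) (hY : ∀ n, n ≠ 0 → IsZero (Y.X n))
    (hZ : ∀ n, n ≠ 0 → IsZero (Z.X n))
    (h : E.conflation (ShortComplex.mk (φ.f 0) (ψ.f 0) (by
      rw [← HomologicalComplex.comp_f, w, HomologicalComplex.zero_f]))) :
    E.IsAcyclic (mappingCone (mappingCone.desc φ 0 ψ (by simp [w]))) := by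
  have hC (n : ℤ) (h₀ : n ≠ 0) (h₁ : n ≠ -1) : IsZero ((mappingCone φ).X n) := by
    rw [isZero_X_iff]
    exact ⟨hX _ (by lia), hY _ h₀⟩
  set σ := mappingCone.desc φ 0 ψ (by simp [w]) with hσ
  refine isAcyclic_of_conflation _ (fun n hn => ?_) ?_
  · rw [isZero_X_iff]
    exact ⟨hC _ (by lia) (by lia), hZ _ (by lia)⟩
  · have := isIso_inl_v φ 0 (-1) rfl (hY _ (by simp))
    have := isIso_inl_v σ (-1) (-2) rfl (hZ _ (by simp))
    have := isIso_inr_f φ 0 1 rfl (hX _ (by simp))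
    have := isIso_inl_v σ 0 (-1) rfl (hZ _ (by simp))
    have := isIso_inr_f σ 0 1 rfl (hC _ (by simp) (by simp))
    -- The outer cone carries the negative of the differential of the inner cone; the sign on the
    -- first component compensates for it.
    refine E.of_iso (ShortComplex.isoMk
      (-(asIso ((inl φ).v 0 (-1) rfl) ≪≫ asIso ((inl σ).v (-1) (-2) rfl)))
      (asIso ((inr φ).f 0) ≪≫ asIso ((inl σ).v 0 (-1) rfl)) (asIso ((inr σ).f 0)) ?_ ?_) h
    · dsimp
      rw [Preadditive.neg_comp, Category.assoc, inl_v_d σ (-1) (-2) 0 rfl rfl,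
        (hZ (-1) (by simp)).eq_of_tgt (σ.f (-1)) 0, zero_comp, zero_sub, Preadditive.comp_neg,
        neg_neg, inl_v_d_assoc φ 0 (-1) 1 rfl rfl, (hX 1 (by simp)).eq_of_tgt (X.d 0 1) 0]
      simp
    · dsimp
      rw [Category.assoc, inl_v_d σ 0 (-1) 1 rfl rfl, Preadditive.comp_sub,
        inr_f_d_assoc, (hY 1 (by simp)).eq_of_tgt (Y.d 0 1) 0, zero_comp, sub_zero,
        inr_f_desc_f_assoc]

variable [HasZeroObject A]

/-- A conflation gives rise to a distinguished triangle up to a morphism whose cone is acyclic. -/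
lemma exists_distTriang_of_conflation {X Y Z : A} {f : X ⟶ Y} {g : Y ⟶ Z} {w : f ≫ g = 0}
    (h : E.conflation (ShortComplex.mk f g w)) :
    ∃ (W : BoundedHomotopyCategory A) (a : BoundedHomotopyCategory.single.obj Y ⟶ W)
      (b : W ⟶ (BoundedHomotopyCategory.single.obj X)⟦(1 : ℤ)⟧)
      (s : W ⟶ BoundedHomotopyCategory.single.obj Z),
        Triangle.mk (BoundedHomotopyCategory.single.map f) a b ∈ distTriang _ ∧
        a ≫ s = BoundedHomotopyCategory.single.map g ∧ E.acyclic.triangEnvelope.trW s := by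
  obtain ⟨W, a, b, hT⟩ := distinguished_cocone_triangle (BoundedHomotopyCategory.single.map f)
  let φ := (singleFunctor A 0).map f
  let ψ := (singleFunctor A 0).map g
  have w' : φ ≫ ψ = 0 := by rw [← Functor.map_comp, w, Functor.map_zero]
  have hs (U : A) (n : ℤ) (hn : n ≠ 0) : IsZero (((singleFunctor A 0).obj U).X n) :=
    HomologicalComplex.isZero_single_obj_X (ComplexShape.up ℤ) _ _ _ hn
  -- The canonical comparison from the cone of `f` to `Z`; its own cone is acyclic by
  -- `isAcyclic_mappingCone`.
  let σ := mappingCone.desc φ 0 ψ (by simp [w'])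
  let e := isoTriangleOfIso₁₂ ((boundedComplexes A).ι.mapTriangle.obj _)
    (mappingCone.triangleh φ) ((boundedComplexes A).ι.map_distinguished _ hT)
    (HomotopyCategory.mappingCone_triangleh_distinguished φ) (Iso.refl _) (Iso.refl _)
    ((Category.comp_id _).trans (Category.id_comp _).symm)
  have he : a.hom ≫ e.hom.hom₃ = (HomotopyCategory.quotient A _).map (mappingCone.inr φ) :=
    e.hom.comm₂.trans (Category.id_comp _)
  let s : W ⟶ BoundedHomotopyCategory.single.obj Z := ObjectProperty.homMk
    (e.hom.hom₃ ≫ (HomotopyCategory.quotient A (ComplexShape.up ℤ)).map σ)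
  refine ⟨W, a, b, s, hT, ?_, ?_⟩
  · apply (boundedComplexes A).ι.map_injective
    change a.hom ≫ e.hom.hom₃ ≫ (HomotopyCategory.quotient A (ComplexShape.up ℤ)).map σ =
      (HomotopyCategory.quotient A (ComplexShape.up ℤ)).map ψ
    refine (Category.assoc _ _ _).symm.trans ((congr_arg (fun k => k ≫ _) he).trans ?_)
    exact ((HomotopyCategory.quotient A _).map_comp _ _).symm.trans
      (congr_arg _ (mappingCone.inr_desc _ _ _ _))
  · obtain ⟨V, c, d, hV⟩ := distinguished_cocone_triangle s
    refine ⟨V, c, d, hV, ?_⟩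
    have hM : E.IsAcyclic (mappingCone σ) := by
      refine isAcyclic_mappingCone φ ψ w' (hs X) (hs Y) (hs Z) (E.of_iso ?_ h)
      exact ShortComplex.isoMk
        (HomologicalComplex.singleObjXSelf (ComplexShape.up ℤ) 0 X).symm
        (HomologicalComplex.singleObjXSelf (ComplexShape.up ℤ) 0 Y).symm
        (HomologicalComplex.singleObjXSelf (ComplexShape.up ℤ) 0 Z).symm
        (by
          change (HomologicalComplex.singleObjXSelf (ComplexShape.up ℤ) 0 X).inv ≫
            ((HomologicalComplex.single A (ComplexShape.up ℤ) 0).map f).f 0 = f ≫ _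
          rw [HomologicalComplex.single_map_f_self, Iso.inv_hom_id_assoc]
          rfl)
        (by
          change (HomologicalComplex.singleObjXSelf (ComplexShape.up ℤ) 0 Y).inv ≫
            ((HomologicalComplex.single A (ComplexShape.up ℤ) 0).map g).f 0 = g ≫ _
          rw [HomologicalComplex.single_map_f_self, Iso.inv_hom_id_assoc]
          rfl)
    let L : BoundedHomotopyCategory A :=
      ⟨(HomotopyCategory.quotient A (ComplexShape.up ℤ)).obj (mappingCone σ),
        BoundedHomotopyCategory.boundedComplexes_quotient_obj (-2) 0 (by
          intro i hi
          simp only [mappingCone.isZero_X_iff]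
          exact ⟨⟨hs _ _ (by lia), hs _ _ (by lia)⟩, hs _ _ (by lia)⟩) (by
          intro i hi
          simp only [mappingCone.isZero_X_iff]
          exact ⟨⟨hs _ _ (by lia), hs _ _ (by lia)⟩, hs _ _ (by lia)⟩)⟩
    let e' : V.obj ≅ L.obj :=
      Triangle.π₃.mapIso (isoTriangleOfIso₁₂ ((boundedComplexes A).ι.mapTriangle.obj _)
        (mappingCone.triangleh σ) ((boundedComplexes A).ι.map_distinguished _ hV)
        (HomotopyCategory.mappingCone_triangleh_distinguished σ)
        (Triangle.π₃.mapIso e) (Iso.refl _) (Category.comp_id _))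
    exact ObjectProperty.prop_of_iso _ ((boundedComplexes A).isoMk e').symm
      (E.acyclic.le_triangEnvelope L hM)

end ExactStructure

end

/-! ### Calculus of shifts of objects and their iterated extensions -/

namespace shiftsOf

section

variable {A T : Type*} [Category* A] [Category* T] [HasShift T ℤ] {F : A ⥤ T}
  {P P' : ObjectProperty A} {I J : Set ℤ}

lemma of_shift {X : A} {n : ℤ} (hX : P X) (hn : n ∈ I) : shiftsOf F P I ((F.obj X)⟦n⟧) :=
  ⟨X, n, hX, hn, ⟨Iso.refl _⟩⟩

lemma of_obj {X : A} (hX : P X) (h0 : 0 ∈ I) : shiftsOf F P I (F.obj X) :=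
  ⟨X, 0, hX, h0, ⟨((shiftFunctorZero T ℤ).app _).symm⟩⟩

lemma mono (hP : P ≤ P') (hI : I ⊆ J) : shiftsOf F P I ≤ shiftsOf F P' J :=
  fun _ ⟨X, n, hX, hn, e⟩ => ⟨X, n, hP X hX, hI hn, e⟩

lemma shift {Y : T} (n : ℤ) (hI : ∀ i ∈ I, i + n ∈ J) (h : shiftsOf F P I Y) :
    shiftsOf F P J (Y⟦n⟧) := by
  obtain ⟨X, i, hX, hi, ⟨e⟩⟩ := h
  exact ⟨X, i + n, hX, hI i hi,
    ⟨(shiftFunctor T n).mapIso e ≪≫ ((shiftFunctorAdd T i n).app _).symm⟩⟩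

lemma map {A' T' : Type*} [Category* A'] [Category* T'] [HasShift T' ℤ] {F' : A' ⥤ T'}
    {G : T ⥤ T'} [G.CommShift ℤ] {H : A ⥤ A'} (e : ∀ X, G.obj (F.obj X) ≅ F'.obj (H.obj X))
    {P' : ObjectProperty A'}
    (hP : ∀ X, P X → P' (H.obj X)) {Y : T} (h : shiftsOf F P I Y) :
    shiftsOf F' P' I (G.obj Y) := by
  obtain ⟨X, i, hX, hi, ⟨e'⟩⟩ := h
  exact ⟨H.obj X, i, hP X hX, hi,
    ⟨G.mapIso e' ≪≫ (G.commShiftIso i).app _ ≪≫ (shiftFunctor T' i).mapIso (e X)⟩⟩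

lemma hom_eq_zero [Preadditive T] {Y Z : T} (hY : shiftsOf F P I Y)
    (h : ∀ X n, P X → n ∈ I → ∀ f : (F.obj X)⟦n⟧ ⟶ Z, f = 0) (f : Y ⟶ Z) : f = 0 := by
  obtain ⟨X, n, hX, hn, ⟨e⟩⟩ := hY
  rw [← cancel_epi e.inv, h X n hX hn (e.inv ≫ f), comp_zero]

end

end shiftsOf

namespace ExtensionClosure

variable {A T : Type*} [Category* A] [Category* T] [HasZeroObject T] [HasShift T ℤ]
  [Preadditive T] [∀ n : ℤ, (shiftFunctor T n).Additive] [Pretriangulated T] {F : A ⥤ T}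
  {P P' : ObjectProperty A} {I J : Set ℤ} {X : T}

lemma mono_shiftsOf (hP : P ≤ P') (hI : I ⊆ J) :
    ExtensionClosure (shiftsOf F P I) ≤ ExtensionClosure (shiftsOf F P' J) :=
  mono fun _ h => .of (shiftsOf.mono hP hI _ h)

lemma shift_shiftsOf (n : ℤ) (hI : ∀ i ∈ I, i + n ∈ J)
    (hX : ExtensionClosure (shiftsOf F P I) X) : ExtensionClosure (shiftsOf F P J) (X⟦n⟧) :=
  hX.shift n fun _ h => .of (h.shift n hI)

lemma hom_shiftsOf_eq_zero (hX : ExtensionClosure (shiftsOf F P I) X) {Z : T}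
    (h : ∀ X n, P X → n ∈ I → ∀ f : (F.obj X)⟦n⟧ ⟶ Z, f = 0) (f : X ⟶ Z) : f = 0 :=
  hX.hom_eq_zero_of_source (fun _ hY => hY.hom_eq_zero h) f

end ExtensionClosure

namespace ExactStructure

variable {A : Type u} [Category.{v} A] [Preadditive A] (E : ExactStructure A)
  [HasZeroObject A] [HasBinaryBiproducts A]

/-! ### Morphisms from complexes of projective objects -/

/-- A short exact sequence gives a distinguished triangle in the bounded derived category. -/
lemma distTriang_of_conflation {X Y Z : A} {f : X ⟶ Y} {g : Y ⟶ Z} {w : f ≫ g = 0}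
    (h : E.conflation (ShortComplex.mk f g w)) :
    ∃ δ, Triangle.mk (E.single.map f) (E.single.map g) δ ∈ distTriang _ := by
  obtain ⟨W, a, b, s, hT, hs, hW⟩ := E.exists_distTriang_of_conflation h
  let Q := VerdierQuotient.functor E.acyclic
  obtain ⟨e, he⟩ : ∃ e : Q.obj W ≅ Q.obj (BoundedHomotopyCategory.single.obj Z), e.hom = Q.map s :=
    ⟨@asIso _ _ _ _ _ ((VerdierQuotient.isIso_functor_map_iff E.acyclic s).2 hW), rfl⟩
  refine ⟨e.inv ≫ Q.map b ≫ (Q.commShiftIso (1 : ℤ)).hom.app _,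
    DistTriang.of_iso (Q.map_distinguished _ hT) (Iso.refl _) (Iso.refl _) e.symm ?_ ?_ ?_⟩
  · exact (Category.comp_id _).trans (Category.id_comp _).symm
  · change Q.map (BoundedHomotopyCategory.single.map g) ≫ e.inv = 𝟙 _ ≫ Q.map a
    rw [← hs, Functor.map_comp, Category.assoc, ← he, e.hom_inv_id, Category.comp_id,
      Category.id_comp]
  · change _ ≫ (shiftFunctor _ (1 : ℤ)).map (𝟙 _) = _
    exact (congr_arg (_ ≫ ·) ((shiftFunctor _ (1 : ℤ)).map_id _)).trans (Category.comp_id _)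

/-- A bounded complex of projectives is left orthogonal to the subcategory by which the quotient is
formed, so localization does not change the morphisms out of it. -/
lemma map_bijective_of_projectives {X : BoundedHomotopyCategory A}
    (hX : ExtensionClosure (shiftsOf BoundedHomotopyCategory.single E.projectives Set.univ) X)
    (Y : BoundedHomotopyCategory A) :
    Function.Bijective ((VerdierQuotient.functor E.acyclic).map : (X ⟶ Y) → _) := by
  refine ObjectProperty.leftOrthogonal.map_bijective_of_isTriangulated
    (P := E.acyclic.triangEnvelope) (fun K f hK => ?_) _ Y
  exact hX.hom_shiftsOf_eq_zero (fun P n hP _ => E.hom_single_shift_eq_zero_of_acyclic hP hK) f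

/-- The image in the bounded derived category of `X[n]`. -/
noncomputable def singleShiftIso (X : A) (n : ℤ) :
    (VerdierQuotient.functor E.acyclic).obj ((BoundedHomotopyCategory.single.obj X)⟦n⟧) ≅
      (E.single.obj X)⟦n⟧ :=
  ((VerdierQuotient.functor E.acyclic).commShiftIso n).app _

instance : E.single.Additive :=
  inferInstanceAs (BoundedHomotopyCategory.single ⋙ VerdierQuotient.functor E.acyclic).Additive

lemma hom_single_shift_eq_zero_of_projective {P B : A} (hP : E.projectives P) {i j : ℤ}
    (hij : i ≠ j) (f : (E.single.obj P)⟦i⟧ ⟶ (E.single.obj B)⟦j⟧) : f = 0 := by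
  obtain ⟨g, hg⟩ := (E.map_bijective_of_projectives (.of (shiftsOf.of_shift hP (Set.mem_univ i)))
    ((BoundedHomotopyCategory.single.obj B)⟦j⟧)).2
    ((E.singleShiftIso P i).hom ≫ f ≫ (E.singleShiftIso B j).inv)
  rw [BoundedHomotopyCategory.hom_single_shift_single_shift_eq_zero hij g, Functor.map_zero] at hg
  rw [← cancel_epi (E.singleShiftIso P i).hom, ← cancel_mono (E.singleShiftIso B j).inv,
    Category.assoc, ← hg, comp_zero, zero_comp]

lemma single_map_bijective_of_projective {P : A} (hP : E.projectives P) (B : A) :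
    Function.Bijective (E.single.map : (P ⟶ B) → _) := by
  have h₁ := E.map_bijective_of_projectives (X := BoundedHomotopyCategory.single.obj P)
    (.of (shiftsOf.of_obj hP (Set.mem_univ 0))) (BoundedHomotopyCategory.single.obj B)
  exact h₁.comp
    ((Functor.FullyFaithful.ofFullyFaithful BoundedHomotopyCategory.single).map_bijective _ _)

/-! ### Projective resolutions of objects -/

variable {E}

omit [HasZeroObject A] [HasBinaryBiproducts A] in
lemma exists_syzygy (hE : E.EnoughProjectives) (M : A) :
    ∃ (K P : A) (i : K ⟶ P) (p : P ⟶ M) (w : i ≫ p = 0), E.projectives P ∧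
      E.conflation (ShortComplex.mk i p w) := by
  obtain ⟨P, p, hP, K, i, w, h⟩ := hE M
  exact ⟨K, P, i, p, w, hP, h⟩

/-- Every object has arbitrary long projective resolutions in the bounded homotopy category. -/
lemma exists_projective_resolution (hE : E.EnoughProjectives) (k : ℕ) (M : A) :
    ∃ (X : BoundedHomotopyCategory A) (s : X ⟶ BoundedHomotopyCategory.single.obj M),
      E.acyclic.triangEnvelope.trW s ∧
      ObjectProperty.extensionProduct
        (ExtensionClosure
          (shiftsOf BoundedHomotopyCategory.single E.projectives (Set.Ico 0 (k : ℤ))))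
        (shiftsOf BoundedHomotopyCategory.single ⊤ {(k : ℤ)}) X := by
  induction k generalizing M with
  | zero =>
    refine ⟨_, 𝟙 _, MorphismProperty.id_mem _ _, 0, _, 0, 𝟙 _, 0,
      contractible_distinguished₁ _, .zero (isZero_zero _), shiftsOf.of_obj (by trivial) (by simp)⟩
  | succ k hk =>
    obtain ⟨K, P, i, p, w, hP, h⟩ := exists_syzygy hE M
    obtain ⟨W, a, b, s, hT, -, hs⟩ := E.exists_distTriang_of_conflation h
    obtain ⟨X, t, ht, hX⟩ := hk K
    -- Splicing: `X` resolves the syzygy `K`, and the cone of `X ⟶ K ⟶ P` resolves `M`.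
    obtain ⟨Y, c, d, hY⟩ := distinguished_cocone_triangle
      (t ≫ BoundedHomotopyCategory.single.map i)
    obtain ⟨V, c', d', hV⟩ := distinguished_cocone_triangle t
    -- The octahedron compares `Y` with the cone `W` of `K ⟶ P`: the fibre of `Y ⟶ W` is the cone
    -- `V` of `t`, which the quotient kills.
    let o := Triangulated.someOctahedron rfl hV hT hY
    have hV' : E.acyclic.triangEnvelope V := by
      obtain ⟨V', _, _, hV'', h'⟩ := ht
      exact E.acyclic.triangEnvelope.prop_of_iso
        (Triangle.π₃.mapIso (isoTriangleOfIso₁₂ _ _ hV'' hV (Iso.refl _) (Iso.refl _)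
          ((Category.comp_id _).trans (Category.id_comp _).symm))) h'
    refine ⟨Y, o.m₃ ≫ s, MorphismProperty.comp_mem _ _ _
      ((ObjectProperty.trW_iff' _ _).2 ⟨_, _, _, o.mem, hV'⟩) hs, ?_⟩
    have h₁ : ObjectProperty.extensionProduct
      (ExtensionClosure (shiftsOf BoundedHomotopyCategory.single E.projectives
        (Set.Ico 0 (k + 1 : ℕ)))) (ObjectProperty.extensionProduct
      (ExtensionClosure (shiftsOf BoundedHomotopyCategory.single E.projectives
        (Set.Ico 0 (k + 1 : ℕ))))
          (shiftsOf BoundedHomotopyCategory.single ⊤ {((k + 1 : ℕ) : ℤ)})) Y := by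
      refine ⟨_, _, _, _, _, DistTriang.rot hY, .of (shiftsOf.of_obj hP (by simp)), ?_⟩
      obtain ⟨_, _, _, _, _, hT', h₁, h₂⟩ := hX
      refine ⟨_, _, _, _, _, Triangle.shift_distinguished _ hT' 1, h₁.shift_shiftsOf 1 ?_,
        h₂.shift 1 (by simp)⟩
      rintro j ⟨hj, hj'⟩
      constructor <;> push_cast <;> omega
    -- By associativity, `P` and the projective layers of `X⟦1⟧` combine into one iterated
    -- extension.
    rw [← ObjectProperty.extensionProduct_assoc] at h₁
    exact ObjectProperty.monotone_extensionProduct_left _ ExtensionClosure.extensionProduct_le _ h₁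

end ExactStructure

/-! ### Vanishing of negative extensions and the embedding of the exact category -/

namespace ExactStructure

variable {A : Type u} [Category.{v} A] [Preadditive A] {E : ExactStructure A}
  [HasZeroObject A] [HasBinaryBiproducts A]

omit [Preadditive A] [HasZeroObject A] [HasBinaryBiproducts A] in
-- `Y` is built from finitely many shifts of objects, so it suffices that `k` exceeds all of them.
-- It is needed both for the homotopy category and for the derived category.
lemma exists_hom_single_shift_eq_zero {T : Type*} [Category* T] [HasZeroObject T] [HasShift T ℤ]
    [Preadditive T] [∀ n : ℤ, (shiftFunctor T n).Additive] [Pretriangulated T] {F : A ⥤ T}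
    (hF : ∀ ⦃X Y : A⦄ ⦃i j : ℤ⦄, j < i → ∀ f : (F.obj X)⟦i⟧ ⟶ (F.obj Y)⟦j⟧, f = 0) {Y : T}
    (hY : ExtensionClosure (shiftsOf F ⊤ Set.univ) Y) :
    ∃ k₀ : ℤ, ∀ k, k₀ ≤ k → ∀ (X : A) (f : (F.obj X)⟦k⟧ ⟶ Y), f = 0 := by
  induction hY with
  | zero h => exact ⟨0, fun _ _ _ _ => h.eq_of_tgt _ _⟩
  | of h =>
    obtain ⟨Z, n, -, -, ⟨e⟩⟩ := h
    refine ⟨n + 1, fun k hk X f => ?_⟩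
    rw [← cancel_mono e.hom, hF (by lia) (f ≫ e.hom), zero_comp]
  | ext hT _ _ h₁ h₃ =>
    obtain ⟨k₁, h₁⟩ := h₁
    obtain ⟨k₃, h₃⟩ := h₃
    refine ⟨max k₁ k₃, fun k hk X f => ?_⟩
    obtain ⟨g, hg⟩ := DistTriang.lift₂ hT f (h₃ k (le_of_max_le_right hk) X _)
    rw [← hg, h₁ k (le_of_max_le_left hk) X g, zero_comp]

variable (E) in
lemma extensionClosure_shiftsOf_single (Y : E.BoundedDerivedCategory) :
    ExtensionClosure (shiftsOf E.single ⊤ Set.univ) Y := by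
  let Q := VerdierQuotient.functor E.acyclic
  refine (ExtensionClosure (shiftsOf E.single ⊤ Set.univ)).prop_of_iso (Q.objObjPreimageIso Y) ?_
  exact (BoundedHomotopyCategory.extensionClosure_shiftsOf_single _).map Q
    (fun X hX => .of (shiftsOf.map (F := BoundedHomotopyCategory.single) (G := Q)
      (F' := E.single) (H := 𝟭 A) (fun X => Iso.refl (E.single.obj X)) (fun _ h => h) hX))

/-- There are no nonzero morphisms of negative degree between objects of `A` in the bounded
derived category. -/
lemma hom_single_shift_eq_zero (hE : E.EnoughProjectives) {M B : A} {i j : ℤ} (hij : j < i)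
    (f : (E.single.obj M)⟦i⟧ ⟶ (E.single.obj B)⟦j⟧) : f = 0 := by
  let Q := VerdierQuotient.functor E.acyclic
  obtain ⟨φ, hφ⟩ := Localization.exists_rightFraction Q E.acyclic.triangEnvelope.trW
    ((E.singleShiftIso M i).hom ≫ f ≫ (E.singleShiftIso B j).inv)
  obtain ⟨N, u, v, hT, hN⟩ := φ.hs
  obtain ⟨k₀, hk₀⟩ := exists_hom_single_shift_eq_zero
    (fun _ _ _ _ h f => BoundedHomotopyCategory.hom_single_shift_single_shift_eq_zero h.ne' f)
    (BoundedHomotopyCategory.extensionClosure_shiftsOf_single N)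
  -- The length is chosen such that the tail of the resolution, shifted by `i`, lies in shift at
  -- least `k₀`, beyond the range in which stalks map nontrivially to `N`.
  obtain ⟨X, s, hs, P, K, a, b, c, hX, hP, hK⟩ :=
    exists_projective_resolution hE (k₀ - i).toNat M
  obtain ⟨a', b', c', hX'⟩ : ∃ (a' : P⟦i⟧ ⟶ X⟦i⟧) (b' : X⟦i⟧ ⟶ K⟦i⟧) (c' : _),
      Triangle.mk a' b' c' ∈ distTriang _ := ⟨_, _, _, Triangle.shift_distinguished _ hX i⟩
  have hs' := E.acyclic.triangEnvelope.trW.shift hs i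
  have hP' := hP.shift_shiftsOf (J := Set.Ici i) i (by
    rintro j ⟨hj, -⟩
    simpa using hj)
  have hK' := hK.shift (J := Set.Ici (max k₀ i)) i (by
    rintro _ rfl
    simp
    omega)
  -- The resolution dominates the denominator of the fraction: on `X⟦i⟧` the obstruction in `N`
  -- vanishes, on the projective part by orthogonality and on the tail by the choice of `k₀`.
  obtain ⟨t, ht⟩ : ∃ t, t ≫ φ.s = s⟦i⟧' := by
    refine DistTriang.lift₂ hT _ ?_
    obtain ⟨l, hl⟩ := DistTriang.desc₂ hX' (s⟦i⟧' ≫ u) (hP'.hom_shiftsOf_eq_zero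
      (fun P n hP _ => E.hom_single_shift_eq_zero_of_acyclic hP hN) _)
    rw [← hl, hK'.hom_eq_zero (fun X n _ hn => hk₀ n ((le_max_left _ _).trans hn) X) l, comp_zero]
  -- All layers of `X⟦i⟧` are in shifts at least `i > j`, so the numerator dies already in the
  -- homotopy category.
  have ht' : t ≫ φ.f = 0 := by
    obtain ⟨l, hl⟩ := DistTriang.desc₂ hX' (t ≫ φ.f) (hP'.hom_shiftsOf_eq_zero
      (fun P n _ hn => BoundedHomotopyCategory.hom_single_shift_single_shift_eq_zero
        (hij.trans_le hn).ne') _)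
    rw [← hl, hK'.hom_eq_zero (fun X n _ hn =>
      BoundedHomotopyCategory.hom_single_shift_single_shift_eq_zero
        (hij.trans_le ((le_max_right _ _).trans hn)).ne') l, comp_zero]
  have := Localization.inverts Q _ _ hs'
  rw [← cancel_epi (E.singleShiftIso M i).hom, ← cancel_mono (E.singleShiftIso B j).inv,
    Category.assoc, hφ, ← cancel_epi (Q.map (s⟦i⟧')), ← ht, Functor.map_comp, Category.assoc,
    MorphismProperty.RightFraction.map_s_comp_map, ← Functor.map_comp, ht', Functor.map_zero]
  simp

lemma exists_hom_single_shift_eq_zero_derived (hE : E.EnoughProjectives)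
    (Y : E.BoundedDerivedCategory) :
    ∃ k₀ : ℤ, ∀ k, k₀ ≤ k → ∀ (X : A) (f : (E.single.obj X)⟦k⟧ ⟶ Y), f = 0 := by
  exact exists_hom_single_shift_eq_zero (fun _ _ _ _ h f => hom_single_shift_eq_zero hE h f)
    (E.extensionClosure_shiftsOf_single Y)

lemma single_faithful (hE : E.EnoughProjectives) : E.single.Faithful where
  map_injective {M B} f g h := by
    obtain ⟨K, P, i, p, w, hP, hS⟩ := exists_syzygy hE M
    have : Epi p := epi_g hS
    rw [← cancel_epi p]
    apply (E.single_map_bijective_of_projective hP B).1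
    rw [Functor.map_comp, Functor.map_comp, h]

/-- A morphism `f : M ⟶ B` of the derived category restricts to `P ⟶ B`, which comes from `A` and
descends to some `v : M ⟶ B`. The difference of `f` and the image of `v` factors through `K⟦1⟧ ⟶ B`,
which has negative degree and vanishes. -/
lemma single_full (hE : E.EnoughProjectives) : E.single.Full where
  map_surjective {M B} f := by
    have := single_faithful hE
    obtain ⟨K, P, i, p, w, hP, hS⟩ := exists_syzygy hE M
    obtain ⟨δ, hT⟩ := E.distTriang_of_conflation hS
    obtain ⟨u, hu⟩ := (E.single_map_bijective_of_projective hP B).2 (E.single.map p ≫ f)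
    obtain ⟨v, rfl⟩ : ∃ v, p ≫ v = u := exists_desc hS u (by
      apply E.single.map_injective
      rw [Functor.map_comp, Functor.map_zero, hu, ← Category.assoc, DistTriang.zero₁₂ hT,
        zero_comp])
    refine ⟨v, ?_⟩
    obtain ⟨l, hl⟩ := DistTriang.desc₃ hT (E.single.map v - f) (by
      rw [Preadditive.comp_sub, ← Functor.map_comp, hu, sub_self])
    rw [← sub_eq_zero, ← hl]
    have : l ≫ ((shiftFunctorZero _ ℤ).app (E.single.obj B)).inv = 0 :=
      hom_single_shift_eq_zero hE (by simp) _
    rw [← cancel_mono ((shiftFunctorZero _ ℤ).app (E.single.obj B)).inv, Category.assoc, this,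
      comp_zero, zero_comp]

end ExactStructure

/-! ### Deflations onto summands and truncated projective resolutions -/

namespace ExactStructure

section

variable {A : Type u} [Category.{v} A] [Preadditive A] {E : ExactStructure A}

lemma isDeflation_of_isPullback {Y Z Z' Y' : A} {b' : Y' ⟶ Y} {p' : Y' ⟶ Z'} {p : Y ⟶ Z}
    {b : Z' ⟶ Z} (sq : IsPullback b' p' p b) (hp : IsDeflation E.conflation p) :
    IsDeflation E.conflation p' := by
  obtain ⟨Y'', b'', p'', sq', X, i, w, h⟩ := E.pullback p b hp
  refine ⟨X, i ≫ (sq'.isoIsPullback _ _ sq).hom, by simp [w], E.of_iso ?_ h⟩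
  exact ShortComplex.isoMk (Iso.refl _) (sq'.isoIsPullback _ _ sq) (Iso.refl _) (by simp) (by simp)

variable [HasZeroObject A] [HasBinaryBiproducts A]

lemma isDeflation_biprod_snd (X Y : A) : IsDeflation E.conflation (biprod.snd : X ⊞ Y ⟶ Y) := by
  refine isDeflation_of_isPullback (p := (0 : X ⟶ 0)) (b := 0) (b' := biprod.fst)
    ⟨⟨by simp⟩, ⟨PullbackCone.IsLimit.mk _ (fun s => biprod.lift s.fst s.snd) (by simp) (by simp)
      (fun s m h₁ h₂ => by ext <;> simp [h₁, h₂])⟩⟩ ?_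
  refine ⟨X, 𝟙 X, comp_zero, ?_⟩
  have : IsIso (ShortComplex.mk (𝟙 X) (0 : X ⟶ 0) comp_zero).f := inferInstanceAs (IsIso (𝟙 X))
  exact conflation_of_isIso_f _ (isZero_zero A)

/-- The morphism is `𝟙 ⊞ p`, a pullback of `p`, followed by `(b, 𝟙)`, which is a projection up to an
automorphism of `X ⊞ Z`. -/
lemma isDeflation_biprod_desc {X Y Z : A} (b : X ⟶ Z) {p : Y ⟶ Z}
    (hp : IsDeflation E.conflation p) : IsDeflation E.conflation (biprod.desc b p) := by
  have h₁ : IsDeflation E.conflation (biprod.map (𝟙 X) p) := by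
    refine isDeflation_of_isPullback (p := p) (b := biprod.snd) (b' := biprod.snd)
      ⟨⟨by simp⟩, ⟨PullbackCone.IsLimit.mk _
        (fun s => biprod.lift (s.snd ≫ biprod.fst) s.fst) (by simp) (fun s => ?_)
        (fun s m h₁ h₂ => ?_)⟩⟩ hp
    · ext
      · simp
      · simp [s.condition]
    · ext
      · simp [← h₂]
      · simp [h₁]
  have h₂ : IsDeflation E.conflation (biprod.desc b (𝟙 Z)) := by
    refine isDeflation_of_isPullback (p := (biprod.snd : X ⊞ Z ⟶ Z)) (b := 𝟙 Z)
      (b' := biprod.lift biprod.fst (biprod.desc b (𝟙 Z))) ?_ (isDeflation_biprod_snd X Z)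
    have : IsIso (biprod.lift biprod.fst (biprod.desc b (𝟙 Z))) :=
      ⟨biprod.lift biprod.fst (biprod.desc (-b) (𝟙 Z)), by ext <;> simp, by ext <;> simp⟩
    exact IsPullback.of_horiz_isIso ⟨by simp⟩
  have : biprod.desc b p = biprod.map (𝟙 X) p ≫ biprod.desc b (𝟙 Z) := by ext <;> simp
  rw [this]
  exact E.deflation_comp _ _ h₁ h₂

omit [HasZeroObject A] in
-- The definition of thickness concerns biproduct summands, and a retract need not have a complement
-- in an additive category. Here the kernel of the deflation provides one.
lemma IsThick.prop_of_section {C : ObjectProperty A} [hC : E.IsThick C] {Y Z : A} {p : Y ⟶ Z}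
    (hp : IsDeflation E.conflation p) {s : Z ⟶ Y} (hs : s ≫ p = 𝟙 Z) (hY : C Y) : C Z := by
  obtain ⟨K, i, w, h⟩ := hp
  have : Mono i := mono_f h
  obtain ⟨r, hr⟩ : ∃ r, r ≫ i = 𝟙 Y - p ≫ s :=
    exists_lift h (𝟙 Y - p ≫ s) (by simp [Preadditive.sub_comp, hs])
  have hir : i ≫ r = 𝟙 K := by
    rw [← cancel_mono i, Category.assoc, hr, Preadditive.comp_sub, reassoc_of% w]
    simp
  have hsr : s ≫ r = 0 := by
    rw [← cancel_mono i, Category.assoc, hr, Preadditive.comp_sub, reassoc_of% hs]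
    simp
  refine hC.summand (Y := K) (C.prop_of_iso ⟨biprod.lift p r, biprod.desc s i, ?_, ?_⟩ hY)
  · simp [hr]
  · ext <;> simp [hs, hir, hsr, w]

instance : E.IsThick ⊤ where
  exists_zero := ⟨0, isZero_zero A, trivial⟩
  of_iso _ _ := trivial
  biprod _ _ := trivial
  summand _ := trivial
  two_of_three₁ _ _ _ := trivial
  two_of_three₂ _ _ _ := trivial
  two_of_three₃ _ _ _ := trivial

variable (E) in
/-- The objects `X` of the bounded derived category for which there is a distinguished triangle
`P ⟶ X ⟶ M⟦k⟧ ⟶ P⟦1⟧`, where `M` belongs to `C` and `P` is a bounded complex of projective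
objects in degrees greater than `-k`. -/
def Resolved (C : ObjectProperty A) (k : ℤ) : ObjectProperty E.BoundedDerivedCategory :=
  ObjectProperty.extensionProduct
    (ExtensionClosure (shiftsOf E.single E.projectives (Set.Iio k))) (shiftsOf E.single C {k})

namespace Resolved

variable {C : ObjectProperty A} {k : ℤ} {X : E.BoundedDerivedCategory}

instance : (E.Resolved C k).IsClosedUnderIsomorphisms :=
  inferInstanceAs (ObjectProperty.extensionProduct _ _).IsClosedUnderIsomorphisms

lemma mono {C' : ObjectProperty A} (h : C ≤ C') : E.Resolved C k ≤ E.Resolved C' k :=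
  ObjectProperty.monotone_extensionProduct_right _ (shiftsOf.mono h subset_rfl)

lemma exists_triangle (h : E.Resolved C k X) :
    ∃ (P : E.BoundedDerivedCategory) (M : A) (f : P ⟶ X) (g : X ⟶ (E.single.obj M)⟦k⟧)
      (δ : (E.single.obj M)⟦k⟧ ⟶ P⟦(1 : ℤ)⟧),
      ExtensionClosure (shiftsOf E.single E.projectives (Set.Iio k)) P ∧ C M ∧
      Triangle.mk f g δ ∈ distTriang _ := by
  obtain ⟨P, L, f, g, δ, hT, hP, M, _, hM, rfl, ⟨e⟩⟩ := h
  refine ⟨P, M, f, g ≫ e.hom, e.inv ≫ δ, hP, hM, ?_⟩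
  exact DistTriang.of_iso hT (Iso.refl _) (Iso.refl _) e.symm (by simp) (by simp) (by simp)

lemma shift (n m : ℤ) (hm : k + n = m) (h : E.Resolved C k X) : E.Resolved C m (X⟦n⟧) := by
  subst hm
  obtain ⟨P, L, f, g, δ, hT, hP, hL⟩ := h
  exact ⟨_, _, _, _, _, Triangle.shift_distinguished _ hT n,
    hP.shift_shiftsOf n (fun i hi => by simpa using hi), hL.shift n (by simp)⟩

lemma of_obj {M : A} (hM : C M) : E.Resolved C 0 (E.single.obj M) :=
  ⟨0, _, 0, 𝟙 _, 0, contractible_distinguished₁ _, .zero (isZero_zero _),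
    shiftsOf.of_obj hM rfl⟩

/-- A short exact sequence `0 ⟶ K ⟶ P ⟶ M ⟶ 0` turns a resolution ending in `M` into a longer
resolution ending in `K`. -/
lemma succ_of_forall {C' : ObjectProperty A}
    (hC : ∀ M, C M → ∃ (K P : A) (i : K ⟶ P) (p : P ⟶ M) (w : i ≫ p = 0), E.projectives P ∧
      E.conflation (ShortComplex.mk i p w) ∧ C' K)
    (h : E.Resolved C k X) : E.Resolved C' (k + 1) X := by
  obtain ⟨Q, M, f, g, δ, hQ, hM, hT⟩ := h.exists_triangle
  obtain ⟨K, P, i, p, w, hP, hS, hK⟩ := hC M hM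
  obtain ⟨δ', hT'⟩ := E.distTriang_of_conflation hS
  have h₁ : ObjectProperty.extensionProduct
      (ExtensionClosure (shiftsOf E.single E.projectives (Set.Iio (k + 1))))
      (ObjectProperty.extensionProduct
        (ExtensionClosure (shiftsOf E.single E.projectives (Set.Iio (k + 1))))
        (shiftsOf E.single C' {k + 1})) X := by
    refine ⟨_, _, _, _, _, hT, ExtensionClosure.mono_shiftsOf le_rfl ?_ _ hQ, _, _, _, _, _,
      Triangle.shift_distinguished _ (DistTriang.rot hT') k, .of (shiftsOf.of_shift hP ?_),
      (shiftsOf.of_shift (I := {1}) hK rfl).shift k ?_⟩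
    · exact Set.Iio_subset_Iio (by omega)
    · simp
    · simp [add_comm]
  rw [← ObjectProperty.extensionProduct_assoc] at h₁
  exact ObjectProperty.monotone_extensionProduct_left _ ExtensionClosure.extensionProduct_le _ h₁

lemma succ (hE : E.EnoughProjectives) [hC : E.IsThick C] (hP : E.projectives ≤ C)
    (h : E.Resolved C k X) : E.Resolved C (k + 1) X := by
  refine h.succ_of_forall fun M hM => ?_
  obtain ⟨K, P, i, p, w, hP', hS⟩ := exists_syzygy hE M
  exact ⟨K, P, i, p, w, hP', hS, hC.two_of_three₁ hS (hP _ hP') hM⟩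

lemma of_le (hE : E.EnoughProjectives) [hC : E.IsThick C] (hP : E.projectives ≤ C)
    (h : E.Resolved C k X) {l : ℤ} (hkl : k ≤ l) : E.Resolved C l X := by
  obtain ⟨n, rfl⟩ := Int.le.dest hkl
  induction n with
  | zero => simpa using h
  | succ n hn =>
    have := (hn (by omega)).succ hE hP
    rwa [add_assoc] at this

/-- The class of objects with a resolution is closed under cones. -/
lemma cone (hE : E.EnoughProjectives) [hC : E.IsThick C] (hP : E.projectives ≤ C)
    {Y Z : E.BoundedDerivedCategory} {f : X ⟶ Y} {g : Y ⟶ Z} {h : Z ⟶ X⟦(1 : ℤ)⟧}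
    (hT : Triangle.mk f g h ∈ distTriang _) (hX : E.Resolved C k X) (hY : E.Resolved C k Y) :
    E.Resolved C (k + 1) Z := by
  have := single_full hE
  have := single_faithful hE
  obtain ⟨P, M, a, b, c, hPX, hM, hX'⟩ := hX.exists_triangle
  obtain ⟨Q, N, a', b', c', hQY, hN, hY'⟩ := hY.exists_triangle
  -- The projective part of `X` lies in shifts below `k` and does not map to `N⟦k⟧`, so `f` induces
  -- a morphism of the last terms.
  obtain ⟨φ, hφ⟩ := DistTriang.desc₂ hX' (f ≫ b') (hPX.hom_shiftsOf_eq_zero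
    (fun P n hP hn => E.hom_single_shift_eq_zero_of_projective hP hn.ne) _)
  -- Shifting a triangle by `k` multiplies its morphisms by the sign `(-1) ^ k`, which is built in
  -- here.
  obtain ⟨ψ, hψ⟩ := (shiftFunctor _ k).map_surjective (k.negOnePow • φ)
  obtain ⟨ψ, rfl⟩ := E.single.map_surjective ψ
  -- Adding a projective cover term turns `ψ` into a deflation, whose kernel `L` is in `C` by two
  -- out of three.
  obtain ⟨V, P₀, i, p, w, hP₀, hS⟩ := exists_syzygy hE N
  obtain ⟨L, j, w', hS'⟩ := isDeflation_biprod_desc ψ ⟨_, _, _, hS⟩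
  have hL : C L := hC.two_of_three₁ hS' (hC.biprod hM (hP _ hP₀)) hN
  obtain ⟨δ₁, h₁⟩ := E.distTriang_of_conflation hS'
  obtain ⟨δ₂, h₂⟩ : ∃ δ, Triangle.mk (E.single.map (biprod.inl : M ⟶ M ⊞ P₀))
      (E.single.map biprod.snd) δ ∈ distTriang _ := by
    refine E.distTriang_of_conflation (w := by simp) (conflation_of_kernel
      (isDeflation_biprod_snd M P₀) _ _ fun t ht => ⟨t ≫ biprod.fst, ?_⟩)
    ext <;> simp [ht]
  obtain ⟨W, u, v, hW⟩ := distinguished_cocone_triangle (E.single.map ψ)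
  -- From `M ⟶ M ⊞ P₀ ⟶ N`: the cone `W` of `ψ` is an extension of `L⟦1⟧` by `P₀`.
  have o₁ := Triangulated.someOctahedron
    (show E.single.map biprod.inl ≫ E.single.map (biprod.desc ψ p) = E.single.map ψ by
      rw [← Functor.map_comp, biprod.inl_desc]) h₂ (DistTriang.rot h₁) hW
  obtain ⟨u', v', hW'⟩ : ∃ (u' : (E.single.obj N)⟦k⟧ ⟶ W⟦k⟧)
      (v' : W⟦k⟧ ⟶ ((E.single.obj M)⟦k⟧)⟦(1 : ℤ)⟧), Triangle.mk φ u' v' ∈ distTriang _ := by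
    have hφ' : k.negOnePow • (E.single.map ψ)⟦k⟧' = φ := by
      rw [hψ, smul_smul, Int.units_mul_self, one_smul]
    rw [← hφ']
    exact ⟨_, _, Triangle.shift_distinguished _ hW k⟩
  obtain ⟨V', u'', v'', hV'⟩ := distinguished_cocone_triangle (f ≫ b')
  -- The morphism `X ⟶ N⟦k⟧` factors through `M⟦k⟧` and through `Y`. The two octahedra give
  -- triangles `P⟦1⟧ ⟶ V' ⟶ W⟦k⟧` and `Z ⟶ V' ⟶ Q⟦1⟧`.
  have o₂ := Triangulated.someOctahedron hφ (DistTriang.rot hX') hW' hV'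
  have o₃ := Triangulated.someOctahedron rfl hT (DistTriang.rot hY') hV'
  let S := ExtensionClosure (shiftsOf E.single E.projectives (Set.Iio (k + 1)))
  -- Unwinding the three octahedra, `Z` has successive layers `Q`, `P⟦1⟧`, `P₀⟦k⟧` and `L⟦k + 1⟧`.
  have h₃ : S.extensionProduct (S.extensionProduct (S.extensionProduct
      (shiftsOf E.single C {k + 1}))) Z := by
    refine ⟨_, _, _, _, _, inv_rot_of_distTriang _ o₃.mem, ?_,
      _, _, _, _, _, o₂.mem, hPX.shift_shiftsOf 1 ?_,
      _, _, _, _, _, Triangle.shift_distinguished _ o₁.mem k, .of (shiftsOf.of_shift hP₀ ?_),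
      (shiftsOf.of_shift (I := {1}) hL rfl).shift k ?_⟩
    · refine (hQY.shift_shiftsOf (J := Set.Iio (k + 1)) 1 ?_).shift_shiftsOf (-1) ?_
      all_goals
        intro i hi
        simp at hi ⊢
        omega
    · intro i hi
      simpa using hi
    · simp
    · simp [add_comm]
  rw [← ObjectProperty.extensionProduct_assoc, ← ObjectProperty.extensionProduct_assoc] at h₃
  refine ObjectProperty.monotone_extensionProduct_left _ ?_ _ h₃
  rintro K ⟨_, _, _, _, _, hT, h₁, h₃⟩
  exact .ext hT (ExtensionClosure.extensionProduct_le _ h₁) h₃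

end Resolved

end

end ExactStructure

/-! ### Thickness of the class of resolved objects -/

namespace ExactStructure

variable {A : Type u} [Category.{v} A] [Preadditive A] {E : ExactStructure A}
  [HasZeroObject A] [HasBinaryBiproducts A]

namespace Resolved

variable {C : ObjectProperty A} {k : ℤ} {X : E.BoundedDerivedCategory}

/-- Rotation exhibits `Y⟦1⟧` as the cone of `Z ⟶ X⟦1⟧`, with both ends resolved at `k + 1`. The cone
is resolved at `k + 2`, and shifting back loses one. -/
lemma extension (hE : E.EnoughProjectives) [hC : E.IsThick C] (hP : E.projectives ≤ C)
    {Y Z : E.BoundedDerivedCategory} {f : X ⟶ Y} {g : Y ⟶ Z} {h : Z ⟶ X⟦(1 : ℤ)⟧}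
    (hT : Triangle.mk f g h ∈ distTriang _) (hX : E.Resolved C k X) (hZ : E.Resolved C k Z) :
    E.Resolved C (k + 1) Y := by
  have := cone hE hP (DistTriang.rot (DistTriang.rot hT)) (hZ.succ hE hP) (hX.shift 1 (k + 1) rfl)
  exact (E.Resolved C (k + 1)).prop_of_iso ((shiftEquiv _ (1 : ℤ)).unitIso.app Y).symm
    (this.shift (-1) (k + 1) (by ring))

/-- Resolutions are compatible with retracts. -/
lemma prop_of_retract (hE : E.EnoughProjectives) [hC : E.IsThick C] (hP : E.projectives ≤ C)
    {C' : ObjectProperty A} {X' : E.BoundedDerivedCategory} (r : Retract X X')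
    (hX : E.Resolved C' k X) (hX' : E.Resolved C k X') : E.Resolved (C ⊓ C') k X := by
  have := single_full hE
  have := single_faithful hE
  obtain ⟨P, M, a, b, c, hPX, hM, hT⟩ := hX.exists_triangle
  obtain ⟨P', M', a', b', c', hPX', hM', hT'⟩ := hX'.exists_triangle
  have h₀ {P : E.BoundedDerivedCategory} {k : ℤ} {M : A}
      (hP : ExtensionClosure (shiftsOf E.single E.projectives (Set.Iio k)) P)
      (f : P ⟶ (E.single.obj M)⟦k⟧) : f = 0 :=
    hP.hom_shiftsOf_eq_zero
      (fun P n hP hn => E.hom_single_shift_eq_zero_of_projective hP (ne_of_lt hn)) f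
  -- The retraction induces `φ : M ⟶ M'` and `ψ : M' ⟶ M`, which compose to the identity only up to
  -- a morphism that factors through `P⟦1⟧`.
  obtain ⟨φ, hφ⟩ := DistTriang.desc₂ hT (r.i ≫ b') (h₀ hPX _)
  obtain ⟨ψ, hψ⟩ := DistTriang.desc₂ hT' (r.r ≫ b) (h₀ hPX' _)
  obtain ⟨φ, rfl⟩ := (shiftFunctor _ k).map_surjective φ
  obtain ⟨φ, rfl⟩ := E.single.map_surjective φ
  obtain ⟨ψ, rfl⟩ := (shiftFunctor _ k).map_surjective ψ
  obtain ⟨ψ, rfl⟩ := E.single.map_surjective ψ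
  obtain ⟨l, hl⟩ := DistTriang.desc₃ hT ((E.single.map (φ ≫ ψ - 𝟙 M))⟦k⟧') (by
    rw [Functor.map_sub, Functor.map_sub, Preadditive.comp_sub, Functor.map_comp, Functor.map_comp,
      reassoc_of% hφ, hψ, r.retract_assoc,
      CategoryTheory.Functor.map_id, CategoryTheory.Functor.map_id, Category.comp_id,
      sub_self])
  obtain ⟨K, P₀, i, p, w, hP₀, hS⟩ := exists_syzygy hE M
  obtain ⟨δ, hT₀⟩ := E.distTriang_of_conflation hS
  obtain ⟨i', p', δ', hT₀', hp⟩ : ∃ (i' : (E.single.obj K)⟦k⟧ ⟶ (E.single.obj P₀)⟦k⟧)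
      (p' : (E.single.obj P₀)⟦k⟧ ⟶ (E.single.obj M)⟦k⟧)
      (δ' : (E.single.obj M)⟦k⟧ ⟶ ((E.single.obj K)⟦k⟧)⟦(1 : ℤ)⟧),
      Triangle.mk i' p' δ' ∈ distTriang _ ∧ p' = k.negOnePow • (E.single.map p)⟦k⟧' :=
    ⟨_, _, _, Triangle.shift_distinguished _ hT₀ k, rfl⟩
  -- The layers of `P⟦1⟧` are projectives in shifts below `k + 1`, so there is no obstruction in
  -- `K⟦k + 1⟧` and the error lifts to `P₀⟦k⟧`.
  obtain ⟨m, hm⟩ := DistTriang.lift₃ hT₀' l (by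
    let e : ((E.single.obj K)⟦k⟧)⟦(1 : ℤ)⟧ ≅ (E.single.obj K)⟦k + 1⟧ :=
      ((shiftFunctorAdd _ k 1).app _).symm
    rw [← cancel_mono e.hom, h₀ (hPX.shift_shiftsOf 1 (by
      intro i hi
      simpa using hi)) ((l ≫ δ') ≫ e.hom), zero_comp])
  obtain ⟨n, hn⟩ := (shiftFunctor _ k).map_surjective (k.negOnePow • c ≫ m)
  obtain ⟨n, rfl⟩ := E.single.map_surjective n
  have hn' : n ≫ p = φ ≫ ψ - 𝟙 M := by
    apply E.single.map_injective
    apply (shiftFunctor _ k).map_injective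
    rw [← hl, ← hm, hp, Functor.map_comp, Functor.map_comp, hn]
    simp
  refine ⟨P, _, a, b, c, hT, hPX, shiftsOf.of_shift ⟨?_, hM⟩ rfl⟩
  -- The error term is `n ≫ p`, so `(φ, -n)` is a section of the deflation `M' ⊞ P₀ ⟶ M`.
  refine IsThick.prop_of_section (isDeflation_biprod_desc ψ ⟨_, _, _, hS⟩)
    (s := biprod.lift φ (-n)) ?_ (hC.biprod hM' (hP _ hP₀))
  simp [hn']

end Resolved

variable (E) in
/-- The objects of the bounded derived category that have a resolution by projective objects that
ends in an object of `C`. -/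
def resolvedObjects (C : ObjectProperty A) : ObjectProperty E.BoundedDerivedCategory :=
  fun X => ∃ k, E.Resolved C k X

section

variable (hE : E.EnoughProjectives) {C : ObjectProperty A} [hC : E.IsThick C]
  (hP : E.projectives ≤ C)

instance : (E.resolvedObjects C).IsClosedUnderIsomorphisms :=
  ⟨fun e ⟨k, h⟩ => ⟨k, (E.Resolved C k).prop_of_iso e h⟩⟩

include hE hP

lemma isTriangulated_resolvedObjects : (E.resolvedObjects C).IsTriangulated where
  exists_zero :=
    ⟨_, E.single.map_isZero (isZero_zero A), 0, .of_obj (C.prop_of_isZero (isZero_zero A))⟩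
  isStableUnderShiftBy n := ⟨fun _ ⟨k, h⟩ => ⟨k + n, h.shift n _ rfl⟩⟩
  toIsTriangulatedClosed₂ := .mk' fun _ hT ⟨k₁, h₁⟩ ⟨k₃, h₃⟩ =>
    ⟨_, .extension hE hP hT (h₁.of_le hE hP (le_max_left k₁ k₃))
      (h₃.of_le hE hP (le_max_right k₁ k₃))⟩

lemma extensionClosure_shiftsOf_le_resolvedObjects :
    ExtensionClosure (shiftsOf E.single C Set.univ) ≤ E.resolvedObjects C := by
  have := isTriangulated_resolvedObjects hE hP
  refine ExtensionClosure.le_of_isTriangulated ?_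
  rintro X ⟨M, n, hM, -, ⟨e⟩⟩
  exact ⟨_, (E.Resolved C _).prop_of_iso e.symm ((Resolved.of_obj hM).shift n _ rfl)⟩

omit hP hC in
lemma resolvedObjects_top (X : E.BoundedDerivedCategory) : E.resolvedObjects ⊤ X :=
  extensionClosure_shiftsOf_le_resolvedObjects hE le_top _ (E.extensionClosure_shiftsOf_single X)

lemma isThickSubcategory_resolvedObjects : IsThickSubcategory (E.resolvedObjects C) where
  isTriangulated := isTriangulated_resolvedObjects hE hP
  isStableUnderRetracts := ⟨fun {X X'} r ⟨k, h⟩ => by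
    obtain ⟨l, hl⟩ := resolvedObjects_top hE X
    exact ⟨_, Resolved.mono inf_le_left _ (Resolved.prop_of_retract hE hP r
      (hl.of_le hE le_top (le_max_right k l)) (h.of_le hE hP (le_max_left k l)))⟩⟩

/-- The end term is a `k`-th syzygy of `M`. The condition on it records that membership in `C` can
be carried back from a syzygy to `M` by two out of three. -/
lemma exists_resolved_single (k : ℕ) (M : A) :
    E.Resolved (fun K => C K → C M) k (E.single.obj M) := by
  induction k with
  | zero => exact .of_obj id
  | succ k hk =>
    refine hk.succ_of_forall fun N hN => ?_
    obtain ⟨K, P, i, p, w, hP', hS⟩ := exists_syzygy hE N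
    exact ⟨K, P, i, p, w, hP', hS, fun hK => hN (hC.two_of_three₃ hS hK (hP _ hP'))⟩

/-- A resolution of `M` ending in `C` is compared with a syzygy resolution of the same length, by
the retract lemma for the identity. As in Schanuel's lemma, the syzygy is then in `C`, hence so is
`M`. -/
lemma inverseImage_single_resolvedObjects : (E.resolvedObjects C).inverseImage E.single = C := by
  ext M
  refine ⟨fun ⟨k, hk⟩ => ?_, fun hM => ⟨_, .of_obj hM⟩⟩
  have h₁ := exists_resolved_single hE hP k.toNat M
  obtain ⟨P, N, _, _, _, _, ⟨h₂, h₃⟩, _⟩ := (Resolved.prop_of_retract hE hP (Retract.refl _) h₁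
    (hk.of_le hE hP (by simp))).exists_triangle
  exact h₃ h₂

end

end ExactStructure

/-! ### Dévissage of full faithfulness by the five lemma -/

namespace CategoryTheory.Functor

variable {T T' : Type*} [Category* T] [HasZeroObject T] [HasShift T ℤ] [Preadditive T]
  [∀ n : ℤ, (shiftFunctor T n).Additive] [Pretriangulated T] [Category* T'] [HasZeroObject T']
  [HasShift T' ℤ] [Preadditive T'] [∀ n : ℤ, (shiftFunctor T' n).Additive] [Pretriangulated T']
  (F : T ⥤ T') [F.CommShift ℤ] [F.IsTriangulated]

/-- A form of the five lemma. -/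
lemma map_bijective_of_distTriang {X Y Z W : T} {f : X ⟶ Y} {g : Y ⟶ Z} {h : Z ⟶ X⟦(1 : ℤ)⟧}
    (hT : Triangle.mk f g h ∈ distTriang T)
    (hX : Function.Injective (F.map : (X ⟶ W) → _))
    (hY : Function.Bijective (F.map : (Y ⟶ W) → _))
    (hX' : Function.Bijective (F.map : (X⟦(1 : ℤ)⟧ ⟶ W) → _))
    (hY' : Function.Surjective (F.map : (Y⟦(1 : ℤ)⟧ ⟶ W) → _)) :
    Function.Bijective (F.map : (Z ⟶ W) → _) := by
  have hFT : Triangle.mk (F.map f) (F.map g) (F.map h ≫ (F.commShiftIso (1 : ℤ)).hom.app X) ∈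
      distTriang T' := F.map_distinguished _ hT
  have exact₃ (t : F.obj Z ⟶ F.obj W) (ht : F.map g ≫ t = 0) :
      ∃ l : X⟦(1 : ℤ)⟧ ⟶ W, F.map (h ≫ l) = t := by
    obtain ⟨l, rfl⟩ := DistTriang.desc₃ hFT t ht
    obtain ⟨l', hl'⟩ := hX'.2 ((F.commShiftIso (1 : ℤ)).hom.app X ≫ l)
    exact ⟨l', by rw [Functor.map_comp, hl', Category.assoc]⟩
  refine ⟨(injective_iff_map_eq_zero (F.mapAddHom (X := Z) (Y := W))).2 fun t ht => ?_,
    fun t => ?_⟩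
  · replace ht : F.map t = 0 := ht
    obtain ⟨l, rfl⟩ := DistTriang.desc₃ hT t (hY.1 (by
      rw [Functor.map_comp, ht, comp_zero, Functor.map_zero]))
    obtain ⟨m, hm⟩ := DistTriang.desc₃ (DistTriang.rot hFT)
      ((F.commShiftIso (1 : ℤ)).inv.app X ≫ F.map l) (by
        rw [Category.assoc, Iso.hom_inv_id_app_assoc, ← Functor.map_comp, ht])
    obtain ⟨m', hm'⟩ := hY' ((F.commShiftIso (1 : ℤ)).hom.app Y ≫ m)
    have hl : l = (-f⟦(1 : ℤ)⟧') ≫ m' := hX'.1 (by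
      rw [← cancel_epi ((F.commShiftIso (1 : ℤ)).inv.app X), ← hm, Functor.map_comp, hm',
        Functor.map_neg, Preadditive.neg_comp, Preadditive.neg_comp, Preadditive.comp_neg]
      have : (F.map f)⟦(1 : ℤ)⟧' ≫ (F.commShiftIso (1 : ℤ)).inv.app Y =
        (F.commShiftIso (1 : ℤ)).inv.app X ≫ F.map (f⟦(1 : ℤ)⟧') :=
          (F.commShiftIso (1 : ℤ)).inv.naturality f
      rw [← reassoc_of% this, Iso.inv_hom_id_app_assoc])
    rw [hl, ← Category.assoc, DistTriang.zero₂₃ (DistTriang.rot hT), zero_comp]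
  · obtain ⟨u, hu⟩ := hY.2 (F.map g ≫ t)
    obtain ⟨v, rfl⟩ := DistTriang.desc₂ hT u (hX (by
      rw [Functor.map_comp, hu, ← Category.assoc, DistTriang.zero₁₂ hFT, zero_comp,
        Functor.map_zero]))
    obtain ⟨l, hl⟩ := exact₃ (t - F.map v) (by
      rw [Preadditive.comp_sub, ← Functor.map_comp, hu, sub_self])
    exact ⟨v + h ≫ l, by rw [Functor.map_add, hl]; abel⟩

omit [HasZeroObject T] [HasShift T ℤ] [Preadditive T] [∀ n : ℤ, (shiftFunctor T n).Additive]
  [Pretriangulated T] [HasZeroObject T'] [HasShift T' ℤ] [Preadditive T']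
  [∀ n : ℤ, (shiftFunctor T' n).Additive] [Pretriangulated T'] [F.CommShift ℤ] [F.IsTriangulated] in
lemma map_bijective_of_iso {X X' Y Y' : T} (e : X ≅ X') (e' : Y ≅ Y')
    (h : Function.Bijective (F.map : (X ⟶ Y) → _)) :
    Function.Bijective (F.map : (X' ⟶ Y') → _) := by
  refine ⟨fun a b hab => ?_, fun a => ?_⟩
  · rw [← cancel_epi e.hom, ← cancel_mono e'.inv]
    apply h.1
    simp [hab]
  · obtain ⟨b, hb⟩ := h.2 (F.map e.hom ≫ a ≫ F.map e'.inv)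
    refine ⟨e.inv ≫ b ≫ e'.hom, ?_⟩
    simp only [Functor.map_comp, hb, Category.assoc, Iso.map_inv_hom_id, Category.comp_id,
      Iso.map_inv_hom_id_assoc]

lemma map_bijective_of_distTriang' {X Y Z W : T} {f : X ⟶ Y} {g : Y ⟶ Z} {h : Z ⟶ X⟦(1 : ℤ)⟧}
    (hT : Triangle.mk f g h ∈ distTriang T)
    (hZ' : Function.Injective (F.map : (Z⟦(-1 : ℤ)⟧ ⟶ W) → _))
    (hX : Function.Bijective (F.map : (X ⟶ W) → _))
    (hZ : Function.Bijective (F.map : (Z ⟶ W) → _))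
    (hX' : Function.Surjective (F.map : (X⟦(1 : ℤ)⟧ ⟶ W) → _)) :
    Function.Bijective (F.map : (Y ⟶ W) → _) :=
  F.map_bijective_of_distTriang (inv_rot_of_distTriang _ hT) hZ' hX
    (F.map_bijective_of_iso ((shiftEquiv T (1 : ℤ)).counitIso.app Z).symm (Iso.refl W) hZ) hX'

omit [HasZeroObject T] [HasShift T ℤ] [∀ n : ℤ, (shiftFunctor T n).Additive]
  [Pretriangulated T] [HasZeroObject T'] [HasShift T' ℤ]
  [∀ n : ℤ, (shiftFunctor T' n).Additive] [Pretriangulated T'] [F.CommShift ℤ] [F.IsTriangulated] in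
lemma map_bijective_of_forall_eq_zero [F.PreservesZeroMorphisms] {X Y : T} (h : ∀ f : X ⟶ Y, f = 0)
    (h' : ∀ f : F.obj X ⟶ F.obj Y, f = 0) : Function.Bijective (F.map : (X ⟶ Y) → _) :=
  ⟨fun f g _ => (h f).trans (h g).symm, fun f => ⟨0, by rw [h' f, Functor.map_zero]⟩⟩

/-- The five lemma involves neighbouring shifts, so the induction runs over all `n` at once. -/
lemma map_bijective_of_extensionClosure {S : ObjectProperty T}
    (hS : ∀ X, S X → ∀ (n : ℤ) (Y : T), Function.Bijective (F.map : (X⟦n⟧ ⟶ Y) → _))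
    {X : T} (hX : ExtensionClosure S X) (n : ℤ) (Y : T) :
    Function.Bijective (F.map : (X⟦n⟧ ⟶ Y) → _) := by
  induction hX generalizing n with
  | zero h =>
    have h' := (shiftFunctor T n).map_isZero h
    exact F.map_bijective_of_forall_eq_zero (fun f => h'.eq_of_src _ _)
      fun f => (F.map_isZero h').eq_of_src _ _
  | of h => exact hS _ h n Y
  | ext hT _ _ h₁ h₃ =>
    exact F.map_bijective_of_distTriang' (Triangle.shift_distinguished _ hT n)
      (F.map_bijective_of_iso ((shiftFunctorAdd T n (-1)).app _) (Iso.refl Y) (h₃ _)).1 (h₁ n)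
      (h₃ n) (F.map_bijective_of_iso ((shiftFunctorAdd T n 1).app _) (Iso.refl Y) (h₁ _)).2

end CategoryTheory.Functor

/-! ### Full faithfulness of the derived inclusion of a thick subcategory -/

namespace ExactStructure

variable {A : Type u} [Category.{v} A] [Preadditive A] {E : ExactStructure A}
  [HasZeroObject A] [HasBinaryBiproducts A]

section

variable (C : ObjectProperty A) [E.IsExtensionClosed C]

variable (E) in
/-- The inclusion on derived categories is the one on homotopy categories. -/
noncomputable def functorCompDerivedInclusion :
    VerdierQuotient.functor (E.induced C).acyclic ⋙ E.derivedInclusion C ≅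
      BoundedHomotopyCategory.map C.ι ⋙ VerdierQuotient.functor E.acyclic :=
  Localization.fac _ _ _

noncomputable instance : (E.derivedInclusion C).CommShift ℤ := by
  let : Localization.Lifting (VerdierQuotient.functor (E.induced C).acyclic)
    (E.induced C).acyclic.triangEnvelope.trW
    (BoundedHomotopyCategory.map C.ι ⋙ VerdierQuotient.functor E.acyclic)
    (E.derivedInclusion C) := ⟨E.functorCompDerivedInclusion C⟩
  exact Functor.commShiftOfLocalization (VerdierQuotient.functor (E.induced C).acyclic)
    (E.induced C).acyclic.triangEnvelope.trW ℤ
    (BoundedHomotopyCategory.map C.ι ⋙ VerdierQuotient.functor E.acyclic) (E.derivedInclusion C)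

instance : NatTrans.CommShift (E.functorCompDerivedInclusion C).hom ℤ := by
  let : Localization.Lifting (VerdierQuotient.functor (E.induced C).acyclic)
    (E.induced C).acyclic.triangEnvelope.trW
    (BoundedHomotopyCategory.map C.ι ⋙ VerdierQuotient.functor E.acyclic)
    (E.derivedInclusion C) := ⟨E.functorCompDerivedInclusion C⟩
  exact NatTrans.commShift_iso_hom_of_localization
    (VerdierQuotient.functor (E.induced C).acyclic)
    (E.induced C).acyclic.triangEnvelope.trW ℤ
    (BoundedHomotopyCategory.map C.ι ⋙ VerdierQuotient.functor E.acyclic) (E.derivedInclusion C)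

instance : (E.derivedInclusion C).IsTriangulated := by
  -- Every morphism of the quotient is isomorphic to the image of one, which allows triangulatedness
  -- to be tested after precomposition with the quotient functor.
  have : (VerdierQuotient.functor (E.induced C).acyclic).mapArrow.EssSurj :=
    Localization.essSurj_mapArrow _ (E.induced C).acyclic.triangEnvelope.trW
  exact Functor.isTriangulated_of_precomp_iso (E.functorCompDerivedInclusion C)

variable (E) in
/-- The inclusion on derived categories sends objects of `C` to themselves. -/
noncomputable def derivedInclusionSingleIso (X : C.FullSubcategory) :
    (E.derivedInclusion C).obj ((E.induced C).single.obj X) ≅ E.single.obj X.obj :=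
  (E.functorCompDerivedInclusion C).app (BoundedHomotopyCategory.single.obj X) ≪≫
    (VerdierQuotient.functor E.acyclic).mapIso ((boundedComplexes A).isoMk
      ((HomotopyCategory.quotient A _).mapIso
        ((HomologicalComplex.singleMapHomologicalComplex C.ι _ 0).app X)))

lemma derivedInclusion_map_functor_map {K L : BoundedHomotopyCategory C.FullSubcategory}
    (f : K ⟶ L) :
    (E.derivedInclusion C).map ((VerdierQuotient.functor (E.induced C).acyclic).map f) =
      (E.functorCompDerivedInclusion C).hom.app K ≫
        (VerdierQuotient.functor E.acyclic).map ((BoundedHomotopyCategory.map C.ι).map f) ≫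
        (E.functorCompDerivedInclusion C).inv.app L := by
  have := (E.functorCompDerivedInclusion C).hom.naturality f
  rw [Functor.comp_map, Functor.comp_map] at this
  rw [← reassoc_of% this, Iso.hom_inv_id_app]
  exact (Category.comp_id _).symm

end

section

variable {C : ObjectProperty A} [hC : E.IsThick C]

omit [HasZeroObject A] in
lemma isDeflation_induced_iff {X Y : C.FullSubcategory} (f : X ⟶ Y) :
    IsDeflation (E.induced C).conflation f ↔ IsDeflation E.conflation f.hom := by
  constructor
  · rintro ⟨K, i, w, h⟩
    exact ⟨K.obj, i.hom, congr_arg InducedCategory.Hom.hom w, h⟩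
  · rintro ⟨K, i, w, h⟩
    exact ⟨⟨K, hC.two_of_three₁ h X.2 Y.2⟩, C.homMk i, by ext; exact w, h⟩

variable (hE : E.EnoughProjectives) (hP : E.projectives ≤ C)

include hE hP

omit [HasZeroObject A] in
lemma enoughProjectives_induced : (E.induced C).EnoughProjectives := by
  intro X
  obtain ⟨P, p, hP', hp⟩ := hE X.obj
  refine ⟨⟨P, hP _ hP'⟩, C.homMk p, fun Y Z q hq h => ?_, (isDeflation_induced_iff _).2 hp⟩
  obtain ⟨l, hl⟩ := hP' q.hom ((isDeflation_induced_iff _).1 hq) h.hom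
  exact ⟨C.homMk l, by ext; exact hl⟩

omit [HasZeroObject A] in
-- A projective object of `C` is a retract of a projective object of `A`, since the deflation from
-- the latter is also a deflation in `C`.
lemma projectives_of_projectives_induced {X : C.FullSubcategory}
    (hX : (E.induced C).projectives X) : E.projectives X.obj := by
  obtain ⟨P, p, hP', hp⟩ := hE X.obj
  let p' : (⟨P, hP _ hP'⟩ : C.FullSubcategory) ⟶ X := C.homMk p
  obtain ⟨l, hl⟩ := hX p' ((isDeflation_induced_iff p').2 hp) (𝟙 X)
  intro Y Z q hq h
  obtain ⟨m, hm⟩ := hP' q hq (p ≫ h)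
  have hl' : l.hom ≫ p = 𝟙 _ := congr_arg InducedCategory.Hom.hom hl
  exact ⟨l.hom ≫ m, by rw [Category.assoc, hm, reassoc_of% hl']⟩

/-- On both sides the morphisms can be computed in the homotopy category, where the inclusion is
fully faithful. -/
lemma derivedInclusion_map_bijective_of_projective {P : C.FullSubcategory}
    (hP' : (E.induced C).projectives P) (n : ℤ) (Y : (E.induced C).BoundedDerivedCategory) :
    Function.Bijective ((E.derivedInclusion C).map :
      (((E.induced C).single.obj P)⟦n⟧ ⟶ Y) → _) := by
  let Q := VerdierQuotient.functor (E.induced C).acyclic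
  let K : BoundedHomotopyCategory C.FullSubcategory := (BoundedHomotopyCategory.single.obj P)⟦n⟧
  refine Functor.map_bijective_of_iso _ ((E.induced C).singleShiftIso P n)
    (Q.objObjPreimageIso Y) ?_
  have h₁ := (E.induced C).map_bijective_of_projectives (X := K)
    (.of (shiftsOf.of_shift hP' (Set.mem_univ n))) (Q.objPreimage Y)
  have h₂ := E.map_bijective_of_projectives (X := (BoundedHomotopyCategory.map C.ι).obj K)
    (.of (shiftsOf.map (F' := BoundedHomotopyCategory.single)
      (F := BoundedHomotopyCategory.single) (G := BoundedHomotopyCategory.map C.ι) (H := C.ι)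
      (fun X => (boundedComplexes A).isoMk ((HomotopyCategory.quotient A _).mapIso
        ((HomologicalComplex.singleMapHomologicalComplex C.ι _ 0).app X)))
      (fun X hX => projectives_of_projectives_induced hE hP hX)
      (shiftsOf.of_shift hP' (Set.mem_univ n))))
    ((BoundedHomotopyCategory.map C.ι).obj (Q.objPreimage Y))
  have h₃ := h₂.comp ((Functor.FullyFaithful.ofFullyFaithful
    (BoundedHomotopyCategory.map C.ι)).map_bijective K (Q.objPreimage Y))
  let e := E.functorCompDerivedInclusion C
  refine (Function.Bijective.of_comp_iff _ h₁).1 ?_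
  convert ((e.app K).symm.homCongr (e.app (Q.objPreimage Y)).symm).bijective.comp h₃ using 1
  ext f
  exact derivedInclusion_map_functor_map C f

/-- In a truncation `P ⟶ X ⟶ M⟦l⟧` with `l` large, the term `M⟦l⟧` has no morphisms to `Y` before or
after the inclusion, and the five lemma reduces the claim to `P`. -/
lemma derivedInclusion_map_bijective (X Y : (E.induced C).BoundedDerivedCategory) :
    Function.Bijective ((E.derivedInclusion C).map : (X ⟶ Y) → _) := by
  have hE' := enoughProjectives_induced hE hP
  obtain ⟨k₁, hk₁⟩ := exists_hom_single_shift_eq_zero_derived hE' Y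
  obtain ⟨k₂, hk₂⟩ := exists_hom_single_shift_eq_zero_derived hE ((E.derivedInclusion C).obj Y)
  obtain ⟨k, hX⟩ := resolvedObjects_top hE' X
  -- The extra `1` is for the term `M⟦l⟧⟦-1⟧` of the five lemma. Only injectivity is needed there,
  -- so the bound for the target category needs no such margin.
  obtain ⟨l, hl₁, hl₂, hl₃⟩ : ∃ l, k ≤ l ∧ k₁ + 1 ≤ l ∧ k₂ ≤ l :=
    ⟨max k (max (k₁ + 1) k₂), by simp, by simp, by simp⟩
  obtain ⟨P, M, f, g, δ, hP', -, hT⟩ := (hX.of_le hE' le_top hl₁).exists_triangle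
  have h (n : ℤ) := (E.derivedInclusion C).map_bijective_of_extensionClosure (X := P)
    (fun Z ⟨L, m, hL, _, ⟨e⟩⟩ n Y => Functor.map_bijective_of_iso _
      ((shiftFunctorAdd _ m n).app _ ≪≫ (shiftFunctor _ n).mapIso e.symm) (Iso.refl Y)
      (derivedInclusion_map_bijective_of_projective hE hP hL _ Y)) hP' n Y
  refine Functor.map_bijective_of_distTriang' _ hT (fun a b _ => ?_)
    (Functor.map_bijective_of_iso _ ((shiftFunctorZero _ ℤ).app P) (Iso.refl Y) (h 0))
    (Functor.map_bijective_of_forall_eq_zero _ (hk₁ l (by omega) M) fun a => ?_) (h 1).2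
  · let e := (shiftFunctorAdd _ l (-1)).app ((E.induced C).single.obj M)
    rw [← cancel_epi e.hom, hk₁ _ (by omega) M (e.hom ≫ a), hk₁ _ (by omega) M (e.hom ≫ b)]
  · let e := ((E.derivedInclusion C).commShiftIso l).app ((E.induced C).single.obj M) ≪≫
      (shiftFunctor _ l).mapIso (E.derivedInclusionSingleIso C M)
    rw [← cancel_epi e.inv, hk₂ l hl₃ _ (e.inv ≫ a), comp_zero]

lemma derivedInclusion_faithful : (E.derivedInclusion C).Faithful :=
  ⟨fun h => (derivedInclusion_map_bijective hE hP _ _).1 h⟩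

lemma derivedInclusion_full : (E.derivedInclusion C).Full :=
  ⟨fun f => (derivedInclusion_map_bijective hE hP _ _).2 f⟩

end

end ExactStructure

/-! ### The correspondence of thick subcategories -/

namespace ExactStructure

variable {A : Type u} [Category.{v} A] [Preadditive A] {E : ExactStructure A}
  [HasZeroObject A] [HasBinaryBiproducts A]

lemma essImage_derivedInclusion_le (C : ObjectProperty A) [E.IsExtensionClosed C] :
    (E.derivedInclusion C).essImage ≤ ExtensionClosure (shiftsOf E.single C Set.univ) := by
  rintro Y ⟨X, ⟨e⟩⟩
  refine (ExtensionClosure _).prop_of_iso e (ExtensionClosure.map (E.derivedInclusion C)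
    (fun Z hZ => .of ?_) ((E.induced C).extensionClosure_shiftsOf_single X))
  exact hZ.map (F' := E.single) (H := C.ι) (E.derivedInclusionSingleIso C) (fun X _ => X.2)

lemma extensionClosure_shiftsOf_single_le {D : ObjectProperty E.BoundedDerivedCategory}
    [D.IsTriangulated] [D.IsClosedUnderIsomorphisms] {C : ObjectProperty A}
    (hD : ∀ M, C M → D (E.single.obj M)) (I : Set ℤ) :
    ExtensionClosure (shiftsOf E.single C I) ≤ D := by
  refine ExtensionClosure.le_of_isTriangulated ?_
  rintro X ⟨M, n, hM, -, ⟨e⟩⟩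
  exact D.prop_of_iso e.symm (D.le_shift n _ (hD M hM))

lemma resolvedObjects_le {D : ObjectProperty E.BoundedDerivedCategory} [D.IsTriangulated]
    [D.IsClosedUnderIsomorphisms] {C : ObjectProperty A} (hP : E.projectives ≤ C)
    (hD : ∀ M, C M → D (E.single.obj M)) : E.resolvedObjects C ≤ D := by
  rintro X ⟨k, h⟩
  obtain ⟨P, M, f, g, δ, hP', hM, hT⟩ := h.exists_triangle
  exact D.ext_of_isTriangulatedClosed₂ _ hT
    (extensionClosure_shiftsOf_single_le (fun M h => hD M (hP M h)) _ _ hP')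
    (D.le_shift k _ (hD M hM))

/-- Objects of the source are iterated extensions of shifts of objects of `C`, which gives one
inclusion. For the other, fullness makes the essential image a triangulated subcategory. -/
lemma essImage_derivedInclusion (hE : E.EnoughProjectives) {C : ObjectProperty A}
    [hC : E.IsThick C] (hP : E.projectives ≤ C) :
    (E.derivedInclusion C).essImage = E.resolvedObjects C := by
  have := derivedInclusion_full hE hP
  refine le_antisymm ((essImage_derivedInclusion_le C).trans
    (extensionClosure_shiftsOf_le_resolvedObjects hE hP)) (resolvedObjects_le hP fun M hM => ?_)
  exact ⟨(E.induced C).single.obj ⟨M, hM⟩, ⟨E.derivedInclusionSingleIso C ⟨M, hM⟩⟩⟩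

lemma isThick_inverseImage_single {D : ObjectProperty E.BoundedDerivedCategory}
    (hD : IsThickSubcategory D) : E.IsThick (D.inverseImage E.single) := by
  have := hD.isTriangulated
  have := hD.isStableUnderRetracts
  refine
    { exists_zero := ⟨0, isZero_zero A, D.prop_of_isZero (E.single.map_isZero (isZero_zero A))⟩
      of_iso := fun e h => D.prop_of_iso (E.single.mapIso e) h
      biprod := fun {X Y} hX hY => ?_
      summand := fun {X Y} h =>
        D.prop_of_retract ((⟨biprod.inl, biprod.fst, by simp⟩ : Retract X (X ⊞ Y)).map E.single) h
      two_of_three₁ := fun {S} hS h₂ h₃ => ?_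
      two_of_three₂ := fun {S} hS h₁ h₃ => ?_
      two_of_three₃ := fun {S} hS h₁ h₂ => ?_ }
  · obtain ⟨δ, h⟩ := E.distTriang_of_conflation (conflation_of_kernel
      (isDeflation_biprod_snd X Y) biprod.inl biprod.inl_snd
      fun t ht => ⟨t ≫ biprod.fst, by ext <;> simp [ht]⟩)
    exact D.ext_of_isTriangulatedClosed₂ _ h hX hY
  · obtain ⟨δ, h⟩ := E.distTriang_of_conflation hS
    exact D.ext_of_isTriangulatedClosed₁ _ h h₂ h₃
  · obtain ⟨δ, h⟩ := E.distTriang_of_conflation hS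
    exact D.ext_of_isTriangulatedClosed₂ _ h h₁ h₃
  · obtain ⟨δ, h⟩ := E.distTriang_of_conflation hS
    exact D.ext_of_isTriangulatedClosed₃ _ h h₁ h₂

/-- In the truncation triangle of an object of `D` the projective part lies in `D`, so the third
term does as well. -/
lemma resolvedObjects_inverseImage_single (hE : E.EnoughProjectives)
    {D : ObjectProperty E.BoundedDerivedCategory} (hD : IsThickSubcategory D)
    (hP : E.projectives ≤ D.inverseImage E.single) :
    E.resolvedObjects (D.inverseImage E.single) = D := by
  have := hD.isTriangulated
  have := hD.isStableUnderRetracts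
  refine le_antisymm (resolvedObjects_le hP fun _ h => h) fun X hX => ?_
  obtain ⟨k, h⟩ := resolvedObjects_top hE X
  obtain ⟨P, M, f, g, δ, hP', -, hT⟩ := h.exists_triangle
  refine ⟨k, P, _, f, g, δ, hT, hP', shiftsOf.of_shift ?_ rfl⟩
  exact (D.prop_shift_iff_of_isStableUnderShift _ k).1 (D.ext_of_isTriangulatedClosed₃ _ hT
    (extensionClosure_shiftsOf_single_le hP _ _ hP') hX)

/-- The projectives generate the image of their derived category under shifts and extensions. This
turns the condition of the Verdier quotient correspondence into the one of the theorem. -/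
lemma perfect_le_iff {D : ObjectProperty E.BoundedDerivedCategory} (hD : IsThickSubcategory D) :
    E.perfect ≤ D ↔ ∀ P : A, E.projectives P → D (E.single.obj P) := by
  have := hD.isTriangulated
  have := hD.isStableUnderRetracts
  refine ⟨fun h P hP => h _ ?_, fun h => (essImage_derivedInclusion_le E.projectives).trans
    (extensionClosure_shiftsOf_single_le h _)⟩
  exact ⟨(E.induced E.projectives).single.obj ⟨P, hP⟩,
    ⟨E.derivedInclusionSingleIso E.projectives ⟨P, hP⟩⟩⟩

/-- Thick subcategories of the bounded derived category that contain the projective objects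
correspond to thick subcategories of the exact category that contain the projective objects. -/
noncomputable def thickEquiv (hE : E.EnoughProjectives) :
    {D : ObjectProperty E.BoundedDerivedCategory //
      IsThickSubcategory D ∧ ∀ P : A, E.projectives P → D (E.single.obj P)} ≃
    {C : ObjectProperty A // E.IsThick C ∧ E.projectives ≤ C} where
  toFun D := ⟨D.1.inverseImage E.single, isThick_inverseImage_single D.2.1, D.2.2⟩
  invFun C := ⟨E.resolvedObjects C.1, by
    have := C.2.1
    exact isThickSubcategory_resolvedObjects hE C.2.2, fun _ hP => ⟨0, .of_obj (C.2.2 _ hP)⟩⟩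
  left_inv D := Subtype.ext (resolvedObjects_inverseImage_single hE D.2.1 D.2.2)
  right_inv C := Subtype.ext (by
    have := C.2.1
    exact inverseImage_single_resolvedObjects hE C.2.2)

end ExactStructure

theorem mainTheorem1 {A : Type u} [Category.{v} A] [Preadditive A] [HasZeroObject A]
    [HasBinaryBiproducts A] (E : ExactStructure A) (hE : E.EnoughProjectives) :
    (∃ e : {D : ObjectProperty E.BoundedDerivedCategory //
          IsThickSubcategory D ∧ ∀ P : A, E.projectives P → D (E.single.obj P)} ≃
        {C : ObjectProperty A // E.IsThick C ∧ E.projectives ≤ C},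
      (∀ D, (e D).1 = D.1.inverseImage E.single) ∧
      ∀ (C : ObjectProperty A) [hC : E.IsThick C] (hP : E.projectives ≤ C),
        (E.derivedInclusion C).Full ∧ (E.derivedInclusion C).Faithful ∧
        (e.symm ⟨C, hC, hP⟩).1 = (E.derivedInclusion C).essImage) ∧
    (∃ e : {T : ObjectProperty E.StableDerivedCategory // IsThickSubcategory T} ≃
        {D : ObjectProperty E.BoundedDerivedCategory //
          IsThickSubcategory D ∧ ∀ P : A, E.projectives P → D (E.single.obj P)},
      ∀ T, (e T).1 = T.1.inverseImage E.toStable) ∧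
    ∃ e : {T : ObjectProperty E.StableDerivedCategory // IsThickSubcategory T} ≃
        {C : ObjectProperty A // E.IsThick C ∧ E.projectives ≤ C},
      ∀ T, (e T).1 = T.1.inverseImage (E.single ⋙ E.toStable) := by

  obtain ⟨e, he⟩ := VerdierQuotient.exists_equiv_thick E.perfect
  let e' := e.trans (Equiv.subtypeEquivRight fun D =>
    and_congr_right fun hD => ExactStructure.perfect_le_iff hD)
  refine ⟨⟨ExactStructure.thickEquiv hE, fun _ => rfl, fun C hC hP =>
    ⟨ExactStructure.derivedInclusion_full hE hP, ExactStructure.derivedInclusion_faithful hE hP,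
      (ExactStructure.essImage_derivedInclusion hE hP).symm⟩⟩, ⟨e', he⟩,
    e'.trans (ExactStructure.thickEquiv hE), fun T => ?_⟩
  exact congr_arg
    (fun D : ObjectProperty E.BoundedDerivedCategory => D.inverseImage E.single) (he T)
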